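/- **Conventions.** All C*-algebras and all $*$-homomorphisms are unital, and $\otimes$ is the minimal tensor product of C*-algebras. A (compact) quantum space $\mathbb{X}$ is given by its C*-algebra $\mathrm{C}(\mathbb{X})$, and it is finite if $\dim\mathrm{C}(\mathbb{X})<\infty$. A quantum family of maps $\mathbb{X}\to\mathbb{Y}$ parametrized by $\mathbb{D}$ is a $*$-homomorphism $\Psi\colon\mathrm{C}(\mathbb{Y})\to\mathrm{C}(\mathbb{X})\otimes\mathrm{C}(\mathbb{D})$. The composition of $\Psi_1\colon\mathrm{C}(\mathbb{X}_2)\to\mathrm{C}(\mathbb{X}_1)\otimes\mathrm{C}(\mathbb{D}_1)$ and $\Psi_2\colon\mathrm{C}(\mathbb{X}_3)\to\mathrm{C}(\mathbb{X}_2)\otimes\mathrm{C}(\mathbb{D}_2)$ is $\Psi_1\vartriangle\Psi_2=(\Psi_1\otimes\mathrm{id})\circ\Psi_2\colon\mathrm{C}(\mathbb{X}_3)\to\mathrm{C}(\mathbb{X}_1)\otimes\mathrm{C}(\mathbb{D}_1)\otimes\mathrm{C}(\mathbb{D}_2)$. Two quantum families $\Psi_1,\Psi_2$ of maps $\mathbb{M}\to\mathbb{M}$,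 parametrized by $\mathbb{D}_1$ and $\mathbb{D}_2$, commute if $(\mathrm{id}\otimes\sigma)\circ(\Psi_1\vartriangle\Psi_2)=\Psi_2\vartriangle\Psi_1$, where $\sigma(x\otimes y)=y\otimes x$ is the flip $\mathrm{C}(\mathbb{D}_1)\otimes\mathrm{C}(\mathbb{D}_2)\to\mathrm{C}(\mathbb{D}_2)\otimes\mathrm{C}(\mathbb{D}_1)$. A quantum family $\Phi_{\mathbb{E}}\colon\mathrm{C}(\mathbb{M})\to\mathrm{C}(\mathbb{M})\otimes\mathrm{C}(\mathbb{E})$ is the quantum family of all maps $\mathbb{M}\to\mathbb{M}$ if for every quantum family $\Theta\colon\mathrm{C}(\mathbb{M})\to\mathrm{C}(\mathbb{M})\otimes\mathrm{C}(\mathbb{P})$ there is a unique $*$-homomorphism $\Lambda\colon\mathrm{C}(\mathbb{E})\to\mathrm{C}(\mathbb{P})$ with $(\mathrm{id}\otimes\Lambda)\circ\Phi_{\mathbb{E}}=\Theta$. **Theorem.** Let $\mathbb{M}$ be a finite quantum space and let $\Psi\colon\mathrm{C}(\mathbb{M})\to\mathrm{C}(\mathbb{M})\otimes\mathrm{C}(\mathbb{D})$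 be a quantum family of maps $\mathbb{M}\to\mathbb{M}$. Then there are a compact quantum space $\mathbb{U}$ and a quantum family $\Phi_\Psi\colon\mathrm{C}(\mathbb{M})\to\mathrm{C}(\mathbb{M})\otimes\mathrm{C}(\mathbb{U})$ such that: 1. For every quantum family $\Theta\colon\mathrm{C}(\mathbb{M})\to\mathrm{C}(\mathbb{M})\otimes\mathrm{C}(\mathbb{P})$ commuting with $\Psi$ there is a unique $*$-homomorphism $\Lambda\colon\mathrm{C}(\mathbb{U})\to\mathrm{C}(\mathbb{P})$ such that $(\mathrm{id}\otimes\Lambda)\circ\Phi_\Psi=\Theta$. 2. $\Phi_\Psi$ commutes with $\Psi$. The pair $(\mathbb{U},\Phi_\Psi)$ is determined by 1 and 2 up to a unique isomorphism: if $\Phi'\colon\mathrm{C}(\mathbb{M})\to\mathrm{C}(\mathbb{M})\otimes\mathrm{C}(\mathbb{U}')$ also has these two properties, then there is a unique $*$-isomorphism $e\colon\mathrm{C}(\mathbb{U})\to\mathrm{C}(\mathbb{U}')$ with $(\mathrm{id}\otimes e)\circ\Phi_\Psi=\Phi'$. 3. $\mathbb{U}$ is a compact quantum semigroup with unit: there are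 a $*$-homomorphism $\Delta_{\mathbb{U}}\colon\mathrm{C}(\mathbb{U})\to\mathrm{C}(\mathbb{U})\otimes\mathrm{C}(\mathbb{U})$ with $(\Delta_{\mathbb{U}}\otimes\mathrm{id})\circ\Delta_{\mathbb{U}}=(\mathrm{id}\otimes\Delta_{\mathbb{U}})\circ\Delta_{\mathbb{U}}$ and a character $\epsilon\colon\mathrm{C}(\mathbb{U})\to\mathbb{C}$ with $(\epsilon\otimes\mathrm{id})\circ\Delta_{\mathbb{U}}=(\mathrm{id}\otimes\epsilon)\circ\Delta_{\mathbb{U}}=\mathrm{id}$. Moreover, if $\Phi_{\mathbb{E}}\colon\mathrm{C}(\mathbb{M})\to\mathrm{C}(\mathbb{M})\otimes\mathrm{C}(\mathbb{E})$ is the quantum family of all maps $\mathbb{M}\to\mathbb{M}$, then there are a unique $\Delta_{\mathbb{E}}\colon\mathrm{C}(\mathbb{E})\to\mathrm{C}(\mathbb{E})\otimes\mathrm{C}(\mathbb{E})$ with $\Phi_{\mathbb{E}}\vartriangle\Phi_{\mathbb{E}}=(\mathrm{id}\otimes\Delta_{\mathbb{E}})\circ\Phi_{\mathbb{E}}$ (the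 comultiplication of $\mathbb{E}$) and a unique $\Lambda\colon\mathrm{C}(\mathbb{E})\to\mathrm{C}(\mathbb{U})$ with $(\mathrm{id}\otimes\Lambda)\circ\Phi_{\mathbb{E}}=\Phi_\Psi$; this $\Lambda$ is surjective and intertwines the comultiplications: $\Delta_{\mathbb{U}}\circ\Lambda=(\Lambda\otimes\Lambda)\circ\Delta_{\mathbb{E}}$. -/

import Mathlib

universe u

open scoped TensorProduct

noncomputable section

namespace QuantumFamilies



open UniformSpace

/-! ### Representations and C*-completions -/

/-- A unital `*`-representation of a unital complex `*`-algebra on a Hilbert space. -/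
structure Rep (R : Type u) [Ring R] [StarRing R] [Algebra ℂ R] where
  H : Type u
  [normedAddCommGroup : NormedAddCommGroup H]
  [innerProductSpace : InnerProductSpace ℂ H]
  [completeSpace : CompleteSpace H]
  hom : R →⋆ₐ[ℂ] (H →L[ℂ] H)

attribute [instance] Rep.normedAddCommGroup Rep.innerProductSpace Rep.completeSpace

/-- A family of representations which is pointwise bounded, so that
`x ↦ sup_i ‖π_i x‖` is a (finite) C*-seminorm. -/
structure RepFamily (R : Type u) [Ring R] [StarRing R] [Algebra ℂ R] where
  index : Type (u + 1)
  rep : index → Rep R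
  bdd : ∀ x : R, BddAbove (Set.range fun i => ‖(rep i).hom x‖)

namespace RepFamily

variable {R : Type u} [Ring R] [StarRing R] [Algebra ℂ R] (F : RepFamily R)

set_option linter.unusedSectionVars false

/-- The C*-seminorm `x ↦ sup_i ‖π_i x‖`. -/
def seminorm (x : R) : ℝ := ⨆ i, ‖(F.rep i).hom x‖

theorem le_seminorm (i : F.index) (x : R) : ‖(F.rep i).hom x‖ ≤ F.seminorm x :=
  le_ciSup (F.bdd x) i

theorem seminorm_nonneg (x : R) : 0 ≤ F.seminorm x := Real.iSup_nonneg fun _ => norm_nonneg _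

theorem seminorm_le {x : R} {c : ℝ} (hc : 0 ≤ c) (h : ∀ i, ‖(F.rep i).hom x‖ ≤ c) :
    F.seminorm x ≤ c := Real.iSup_le h hc

theorem seminorm_zero : F.seminorm 0 = 0 :=
  le_antisymm (F.seminorm_le le_rfl fun i => by simp) (F.seminorm_nonneg _)

theorem seminorm_neg (x : R) : F.seminorm (-x) = F.seminorm x := by simp [seminorm]

theorem seminorm_add_le (x y : R) : F.seminorm (x + y) ≤ F.seminorm x + F.seminorm y :=
  F.seminorm_le (add_nonneg (F.seminorm_nonneg x) (F.seminorm_nonneg y)) fun i => by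
    rw [map_add]
    exact (norm_add_le _ _).trans (add_le_add (F.le_seminorm i x) (F.le_seminorm i y))

theorem seminorm_mul_le (x y : R) : F.seminorm (x * y) ≤ F.seminorm x * F.seminorm y :=
  F.seminorm_le (mul_nonneg (F.seminorm_nonneg x) (F.seminorm_nonneg y)) fun i => by
    rw [map_mul]
    exact (norm_mul_le _ _).trans
      (mul_le_mul (F.le_seminorm i x) (F.le_seminorm i y) (norm_nonneg _) (F.seminorm_nonneg x))

theorem seminorm_smul_le (c : ℂ) (x : R) : F.seminorm (c • x) ≤ ‖c‖ * F.seminorm x :=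
  F.seminorm_le (mul_nonneg (norm_nonneg c) (F.seminorm_nonneg x)) fun i => by
    rw [map_smul, norm_smul]
    exact mul_le_mul_of_nonneg_left (F.le_seminorm i x) (norm_nonneg c)

theorem seminorm_star (x : R) : F.seminorm (star x) = F.seminorm x := by
  simp only [seminorm, map_star, norm_star]

theorem mul_self_seminorm_le (x : R) :
    F.seminorm x * F.seminorm x ≤ F.seminorm (star x * x) := by
  have h : F.seminorm x ≤ Real.sqrt (F.seminorm (star x * x)) :=
    F.seminorm_le (Real.sqrt_nonneg _) fun i => by
      apply Real.le_sqrt_of_sq_le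
      rw [pow_two, ← CStarRing.norm_star_mul_self, ← map_star, ← map_mul]
      exact F.le_seminorm i _
  calc F.seminorm x * F.seminorm x
      ≤ Real.sqrt (F.seminorm (star x * x)) * Real.sqrt (F.seminorm (star x * x)) :=
        mul_self_le_mul_self (F.seminorm_nonneg x) h
    _ = _ := Real.mul_self_sqrt (F.seminorm_nonneg _)

/-- The `*`-algebra `R` regarded as a seminormed algebra for the seminorm of the family `F`. -/
def Pre (_F : RepFamily R) : Type u := R

instance : Ring F.Pre := inferInstanceAs (Ring R)
instance : StarRing F.Pre := inferInstanceAs (StarRing R)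
instance : Algebra ℂ F.Pre := inferInstanceAs (Algebra ℂ R)
instance [StarModule ℂ R] : StarModule ℂ F.Pre := ⟨fun c x => star_smul (A := R) c x⟩

/-- The identity map from `R` to its seminormed copy. -/
def toPre : R →⋆ₐ[ℂ] F.Pre := StarAlgHom.id ℂ R

instance : SeminormedRing F.Pre :=
  { (inferInstance : Ring F.Pre),
    (AddGroupSeminorm.toSeminormedAddCommGroup (E := F.Pre)
      { toFun := F.seminorm
        map_zero' := F.seminorm_zero
        add_le' := F.seminorm_add_le
        neg' := F.seminorm_neg } : SeminormedAddCommGroup F.Pre) with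
    norm_mul_le := F.seminorm_mul_le }

theorem norm_toPre (x : R) : ‖F.toPre x‖ = F.seminorm x := rfl

instance : NormedAlgebra ℂ F.Pre where
  norm_smul_le := F.seminorm_smul_le

instance : NormedStarGroup F.Pre where
  norm_star_le x := (F.seminorm_star x).le

/-- The C*-algebra obtained from `R` by separation and completion with respect to the
C*-seminorm `x ↦ sup_i ‖π_i x‖`. -/
def CStarCompletion (F : RepFamily R) : Type u := Completion F.Pre

instance : NormedRing F.CStarCompletion := inferInstanceAs (NormedRing (Completion F.Pre))
instance : CompleteSpace F.CStarCompletion :=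
  Completion.completeSpace (α := F.Pre)
instance : Algebra ℂ F.CStarCompletion := inferInstanceAs (Algebra ℂ (Completion F.Pre))
instance : NormedAlgebra ℂ F.CStarCompletion where
  norm_smul_le := norm_smul_le (α := ℂ) (β := Completion F.Pre)

/-- The canonical map from `R` to its completion, as a plain function. -/
def coe' (x : F.Pre) : F.CStarCompletion := (x : Completion F.Pre)

theorem denseRange_coe' : DenseRange F.coe' := Completion.denseRange_coe

theorem continuous_coe' : Continuous F.coe' := Completion.continuous_coe _

theorem norm_coe' (x : F.Pre) : ‖F.coe' x‖ = ‖x‖ := Completion.norm_coe x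

instance : Star F.CStarCompletion := ⟨(Completion.map star : Completion F.Pre → Completion F.Pre)⟩

theorem continuous_star' : Continuous (star : F.CStarCompletion → F.CStarCompletion) :=
  Completion.continuous_map

theorem star_coe' (x : F.Pre) : star (F.coe' x) = F.coe' (star x) :=
  Completion.map_coe (starNormedAddGroupHom (E := F.Pre)).uniformContinuous x

theorem coe'_mul (x y : F.Pre) : F.coe' (x * y) = F.coe' x * F.coe' y := Completion.coe_mul x y
theorem coe'_add (x y : F.Pre) : F.coe' (x + y) = F.coe' x + F.coe' y := Completion.coe_add x y
theorem coe'_smul (c : ℂ) (x : F.Pre) : F.coe' (c • x) = c • F.coe' x := Completion.coe_smul c x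

theorem induction {p : F.CStarCompletion → Prop} (x : F.CStarCompletion)
    (hp : IsClosed {x | p x}) (ih : ∀ x, p (F.coe' x)) : p x :=
  F.denseRange_coe'.induction_on x hp ih

theorem induction₂ {p : F.CStarCompletion → F.CStarCompletion → Prop}
    (x y : F.CStarCompletion)
    (hp : IsClosed {q : F.CStarCompletion × F.CStarCompletion | p q.1 q.2})
    (ih : ∀ x y, p (F.coe' x) (F.coe' y)) : p x y :=
  F.denseRange_coe'.induction_on₂ hp ih x y

instance : StarRing F.CStarCompletion where
  star_involutive x := F.induction (p := fun x => star (star x) = x) x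
    (isClosed_eq (F.continuous_star'.comp F.continuous_star') continuous_id)
    fun x => by simp [star_coe']
  star_mul x y := F.induction₂ (p := fun x y => star (x * y) = star y * star x) x y
    (isClosed_eq (F.continuous_star'.comp continuous_mul)
      ((F.continuous_star'.comp continuous_snd).mul (F.continuous_star'.comp continuous_fst)))
    fun x y => by simp [star_coe', ← coe'_mul]
  star_add x y := F.induction₂ (p := fun x y => star (x + y) = star x + star y) x y
    (isClosed_eq (F.continuous_star'.comp continuous_add)
      ((F.continuous_star'.comp continuous_fst).add (F.continuous_star'.comp continuous_snd)))
    fun x y => by simp [star_coe', ← coe'_add]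

instance : CStarRing F.CStarCompletion where
  norm_mul_self_le x := F.induction (p := fun x => ‖x‖ * ‖x‖ ≤ ‖star x * x‖) x
    (isClosed_le (continuous_norm.mul continuous_norm)
      (continuous_norm.comp (F.continuous_star'.mul continuous_id))) fun x => by
    simp only [star_coe', ← coe'_mul, norm_coe']
    exact F.mul_self_seminorm_le x

instance [StarModule ℂ R] : StarModule ℂ F.CStarCompletion where
  star_smul c x := F.induction (p := fun x => star (c • x) = star c • star x) x
    (isClosed_eq (F.continuous_star'.comp (continuous_const_smul c))
      ((continuous_const_smul (star c)).comp F.continuous_star')) fun x => by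
    simp only [star_coe', ← coe'_smul, star_smul]

variable [StarModule ℂ R]

instance : CStarAlgebra F.CStarCompletion where

/-- The canonical unital `*`-homomorphism from `R` to its C*-completion. -/
def ofAlg : R →⋆ₐ[ℂ] F.CStarCompletion where
  toFun x := F.coe' (F.toPre x)
  map_one' := Completion.coe_one F.Pre
  map_mul' x y := F.coe'_mul _ _
  map_zero' := Completion.coe_zero
  map_add' x y := F.coe'_add _ _
  commutes' c := rfl
  map_star' x := by rw [map_star, star_coe']

theorem denseRange_ofAlg : DenseRange F.ofAlg := F.denseRange_coe'

theorem norm_ofAlg (x : R) : ‖F.ofAlg x‖ = F.seminorm x := F.norm_coe' _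

theorem hom_ext {B : Type*} [CStarAlgebra B] {f g : F.CStarCompletion →⋆ₐ[ℂ] B}
    (h : ∀ x, f (F.ofAlg x) = g (F.ofAlg x)) : f = g := by
  ext x
  refine F.denseRange_ofAlg.induction_on x (isClosed_eq ?_ ?_) h
  · exact AddMonoidHomClass.continuous_of_bound f 1
      fun x => by simpa using NonUnitalStarAlgHom.norm_apply_le f x
  · exact AddMonoidHomClass.continuous_of_bound g 1
      fun x => by simpa using NonUnitalStarAlgHom.norm_apply_le g x

/-- The continuous extension of a `*`-homomorphism which is bounded by the seminorm of `F`,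
as a ring homomorphism. -/
def liftRingHom {B : Type*} [CStarAlgebra B] (f : R →⋆ₐ[ℂ] B)
    (hf : ∀ x, ‖f x‖ ≤ F.seminorm x) : F.CStarCompletion →+* B :=
  Completion.extensionHom (α := F.Pre) (f.toAlgHom.toRingHom : R →+* B)
    (AddMonoidHomClass.continuous_of_bound (𝓕 := F.Pre →+* B) _ 1 fun x =>
      (hf x).trans (one_mul _).ge)

theorem continuous_liftRingHom {B : Type*} [CStarAlgebra B] (f : R →⋆ₐ[ℂ] B)
    (hf : ∀ x, ‖f x‖ ≤ F.seminorm x) : Continuous (F.liftRingHom f hf) :=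
  Completion.continuous_extension

theorem liftRingHom_ofAlg {B : Type*} [CStarAlgebra B] (f : R →⋆ₐ[ℂ] B)
    (hf : ∀ x, ‖f x‖ ≤ F.seminorm x) (x : R) : F.liftRingHom f hf (F.ofAlg x) = f x :=
  Completion.extensionHom_coe _ _ _

/-- The continuous extension of a `*`-homomorphism which is bounded by the seminorm of `F`. -/
def lift {B : Type*} [CStarAlgebra B] (f : R →⋆ₐ[ℂ] B) (hf : ∀ x, ‖f x‖ ≤ F.seminorm x) :
    F.CStarCompletion →⋆ₐ[ℂ] B :=
  { F.liftRingHom f hf with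
    commutes' := fun c => by
      have h := F.liftRingHom_ofAlg f hf (algebraMap ℂ R c)
      rw [AlgHomClass.commutes f] at h
      exact h
    map_star' := fun x => F.denseRange_ofAlg.induction_on
      (p := fun x => F.liftRingHom f hf (star x) = star (F.liftRingHom f hf x)) x
      (isClosed_eq ((F.continuous_liftRingHom f hf).comp F.continuous_star')
        (continuous_star.comp (F.continuous_liftRingHom f hf))) fun x => by
      rw [← map_star, liftRingHom_ofAlg, liftRingHom_ofAlg, map_star] }

theorem lift_ofAlg {B : Type*} [CStarAlgebra B] (f : R →⋆ₐ[ℂ] B)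
    (hf : ∀ x, ‖f x‖ ≤ F.seminorm x) (x : R) : F.lift f hf (F.ofAlg x) = f x :=
  F.liftRingHom_ofAlg f hf x

/-- Every representation of the family extends to the completion. -/
def extendRep (i : F.index) : F.CStarCompletion →⋆ₐ[ℂ] ((F.rep i).H →L[ℂ] (F.rep i).H) :=
  F.lift (F.rep i).hom (F.le_seminorm i)

theorem norm_le_of_extendRep {y : F.CStarCompletion} {c : ℝ} (hc : 0 ≤ c)
    (h : ∀ i, ‖F.extendRep i y‖ ≤ c) : ‖y‖ ≤ c := by
  refine le_of_forall_pos_le_add fun ε hε => ?_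
  obtain ⟨x, hx⟩ := F.denseRange_ofAlg.exists_dist_lt y (half_pos hε)
  rw [dist_eq_norm] at hx
  have h1 : ‖F.ofAlg x‖ ≤ c + ε / 2 := by
    rw [norm_ofAlg]
    refine F.seminorm_le (by positivity) fun i => ?_
    have h2 : (F.rep i).hom x = F.extendRep i y - F.extendRep i (y - F.ofAlg x) := by
      rw [map_sub, sub_sub_cancel]
      exact (F.lift_ofAlg _ _ x).symm
    rw [h2]
    exact (norm_sub_le _ _).trans
      (add_le_add (h i) ((NonUnitalStarAlgHom.norm_apply_le _ _).trans hx.le))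
  calc ‖y‖ = ‖F.ofAlg x + (y - F.ofAlg x)‖ := by rw [add_sub_cancel]
    _ ≤ c + ε / 2 + ε / 2 := (norm_add_le _ _).trans (add_le_add h1 hx.le)
    _ = c + ε := by ring

end RepFamily

/-! ### Hilbert space tensor products -/

section Hilbert

variable (H K L : Type u)
  [NormedAddCommGroup H] [InnerProductSpace ℂ H] [CompleteSpace H]
  [NormedAddCommGroup K] [InnerProductSpace ℂ K] [CompleteSpace K]
  [NormedAddCommGroup L] [InnerProductSpace ℂ L] [CompleteSpace L]

/-- The Hilbert space tensor product: the completion of the algebraic tensor product. -/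
def HilbertTensor : Type u := Completion (H ⊗[ℂ] K)

instance : NormedAddCommGroup (HilbertTensor H K) :=
  inferInstanceAs (NormedAddCommGroup (Completion (H ⊗[ℂ] K)))

instance : InnerProductSpace ℂ (HilbertTensor H K) :=
  inferInstanceAs (InnerProductSpace ℂ (Completion (H ⊗[ℂ] K)))

instance : CompleteSpace (HilbertTensor H K) := Completion.completeSpace (α := H ⊗[ℂ] K)

variable {H K L}

set_option linter.unusedSectionVars false

/-- The canonical isometry from the algebraic to the Hilbert space tensor product. -/
def toHilbertTensor : H ⊗[ℂ] K →ₗᵢ[ℂ] HilbertTensor H K where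
  toFun x := (x : Completion (H ⊗[ℂ] K))
  map_add' := Completion.coe_add
  map_smul' := Completion.coe_smul
  norm_map' := Completion.norm_coe

theorem denseRange_toHilbertTensor :
    DenseRange (toHilbertTensor : H ⊗[ℂ] K →ₗᵢ[ℂ] HilbertTensor H K) :=
  Completion.denseRange_coe

/-- The canonical isometry into the Hilbert space tensor product as a bounded operator. -/
def toHilbertTensorL : H ⊗[ℂ] K →L[ℂ] HilbertTensor H K :=
  toHilbertTensor.toContinuousLinearMap

/-- The bounded operator `S ⊗ T` on the Hilbert space tensor product, i.e. the continuous
extension of `S ⊗ T` from the algebraic tensor product. -/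
def opTensor (S : H →L[ℂ] H) (T : K →L[ℂ] K) : HilbertTensor H K →L[ℂ] HilbertTensor H K :=
  (toHilbertTensorL ∘L TensorProduct.mapL S T).extend toHilbertTensorL

theorem opTensor_coe (S : H →L[ℂ] H) (T : K →L[ℂ] K) (x : H ⊗[ℂ] K) :
    opTensor S T (toHilbertTensor x) = toHilbertTensor (TensorProduct.mapL S T x) := by
  have h1 : DenseRange (toHilbertTensorL : H ⊗[ℂ] K →L[ℂ] HilbertTensor H K) :=
    denseRange_toHilbertTensor
  have h2 : IsUniformInducing (toHilbertTensorL : H ⊗[ℂ] K →L[ℂ] HilbertTensor H K) :=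
    toHilbertTensor.isometry.isUniformInducing
  exact ContinuousLinearMap.extend_eq (toHilbertTensorL ∘L TensorProduct.mapL S T) h1 h2 x

theorem opTensor_ext {Y : Type*} [NormedAddCommGroup Y] [NormedSpace ℂ Y]
    {S T : HilbertTensor H K →L[ℂ] Y}
    (h : ∀ (x : H) (y : K), S (toHilbertTensor (x ⊗ₜ[ℂ] y)) =
      T (toHilbertTensor (x ⊗ₜ[ℂ] y))) : S = T := by
  ext z
  refine denseRange_toHilbertTensor.induction_on z
    (isClosed_eq S.continuous T.continuous) fun z => ?_
  induction z using TensorProduct.induction_on with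
  | zero => simp
  | tmul x y => exact h x y
  | add x y hx hy => rw [map_add, map_add, map_add, hx, hy]

theorem opTensor_tmul (S : H →L[ℂ] H) (T : K →L[ℂ] K) (x : H) (y : K) :
    opTensor S T (toHilbertTensor (x ⊗ₜ[ℂ] y)) = toHilbertTensor (S x ⊗ₜ[ℂ] T y) := by
  rw [opTensor_coe, TensorProduct.mapL_tmul]

theorem opTensor_one : opTensor (1 : H →L[ℂ] H) (1 : K →L[ℂ] K) = 1 :=
  opTensor_ext fun x y => by simp [opTensor_tmul]

theorem opTensor_mul (S S' : H →L[ℂ] H) (T T' : K →L[ℂ] K) :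
    opTensor (S * S') (T * T') = opTensor S T * opTensor S' T' :=
  opTensor_ext fun x y => by simp [opTensor_tmul]

theorem opTensor_add_left (S S' : H →L[ℂ] H) (T : K →L[ℂ] K) :
    opTensor (S + S') T = opTensor S T + opTensor S' T :=
  opTensor_ext fun x y => by simp [opTensor_tmul, TensorProduct.add_tmul]

theorem opTensor_add_right (S : H →L[ℂ] H) (T T' : K →L[ℂ] K) :
    opTensor S (T + T') = opTensor S T + opTensor S T' :=
  opTensor_ext fun x y => by simp [opTensor_tmul, TensorProduct.tmul_add]

theorem opTensor_smul_left (c : ℂ) (S : H →L[ℂ] H) (T : K →L[ℂ] K) :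
    opTensor (c • S) T = c • opTensor S T :=
  opTensor_ext fun x y => by
    simp [opTensor_tmul, ← TensorProduct.smul_tmul']

theorem opTensor_smul_right (c : ℂ) (S : H →L[ℂ] H) (T : K →L[ℂ] K) :
    opTensor S (c • T) = c • opTensor S T :=
  opTensor_ext fun x y => by
    simp [opTensor_tmul]

theorem opTensor_star (S : H →L[ℂ] H) (T : K →L[ℂ] K) :
    opTensor (star S) (star T) = star (opTensor S T) := by
  rw [ContinuousLinearMap.star_eq_adjoint (opTensor S T), ContinuousLinearMap.eq_adjoint_iff]
  intro x y
  refine denseRange_toHilbertTensor.induction_on₂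
    (p := fun x y => inner ℂ (opTensor (star S) (star T) x) y = inner ℂ x (opTensor S T y))
    (by apply isClosed_eq <;> fun_prop) (fun x y => ?_) x y
  · rw [opTensor_coe, opTensor_coe, LinearIsometry.inner_map_map, LinearIsometry.inner_map_map]
    induction x using TensorProduct.induction_on with
    | zero => simp
    | add x x' hx hx' => rw [map_add, inner_add_left, inner_add_left, hx, hx']
    | tmul a b =>
      induction y using TensorProduct.induction_on with
      | zero => simp
      | add x x' hx hx' => rw [map_add, inner_add_right, inner_add_right, hx, hx']
      | tmul c d =>
        rw [TensorProduct.mapL_tmul, TensorProduct.mapL_tmul, TensorProduct.inner_tmul,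
          TensorProduct.inner_tmul, ContinuousLinearMap.star_eq_adjoint,
          ContinuousLinearMap.star_eq_adjoint, ContinuousLinearMap.adjoint_inner_left,
          ContinuousLinearMap.adjoint_inner_left]

end Hilbert

/-! ### Tensor products of representations -/

section TensorRep

set_option linter.unusedSectionVars false

variable {R S : Type u} [Ring R] [StarRing R] [Algebra ℂ R] [StarModule ℂ R]
  [Ring S] [StarRing S] [Algebra ℂ S] [StarModule ℂ S]

section

variable {H K : Type u}
  [NormedAddCommGroup H] [InnerProductSpace ℂ H] [CompleteSpace H]
  [NormedAddCommGroup K] [InnerProductSpace ℂ K] [CompleteSpace K]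

/-- The linear map `a ⊗ b ↦ f(a) ⊗ g(b)` into operators on the Hilbert space tensor product. -/
def linTensor (f : R →⋆ₐ[ℂ] (H →L[ℂ] H)) (g : S →⋆ₐ[ℂ] (K →L[ℂ] K)) :
    R ⊗[ℂ] S →ₗ[ℂ] (HilbertTensor H K →L[ℂ] HilbertTensor H K) :=
  TensorProduct.lift <| LinearMap.mk₂ ℂ (fun a b => opTensor (f a) (g b))
    (fun a a' b => by rw [map_add, opTensor_add_left])
    (fun c a b => by rw [map_smul, opTensor_smul_left])
    (fun a b b' => by rw [map_add, opTensor_add_right])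
    (fun c a b => by rw [map_smul, opTensor_smul_right])

theorem linTensor_tmul (f : R →⋆ₐ[ℂ] (H →L[ℂ] H)) (g : S →⋆ₐ[ℂ] (K →L[ℂ] K)) (a : R) (b : S) :
    linTensor f g (a ⊗ₜ[ℂ] b) = opTensor (f a) (g b) := rfl

theorem linTensor_star (f : R →⋆ₐ[ℂ] (H →L[ℂ] H)) (g : S →⋆ₐ[ℂ] (K →L[ℂ] K)) (x : R ⊗[ℂ] S) :
    linTensor f g (star x) = star (linTensor f g x) := by
  induction x using TensorProduct.induction_on with
  | zero => simp
  | tmul a b =>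
    rw [TensorProduct.star_tmul, linTensor_tmul, linTensor_tmul, map_star, map_star,
      opTensor_star]
  | add x y hx hy => rw [star_add, map_add, map_add, hx, hy, star_add]

/-- The tensor product of two representations `f` and `g`, a representation of the algebraic
tensor product on the Hilbert space tensor product, `(f ⊗ g)(a ⊗ b) = f(a) ⊗ g(b)`. -/
def homTensor (f : R →⋆ₐ[ℂ] (H →L[ℂ] H)) (g : S →⋆ₐ[ℂ] (K →L[ℂ] K)) :
    R ⊗[ℂ] S →⋆ₐ[ℂ] (HilbertTensor H K →L[ℂ] HilbertTensor H K) :=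
  { Algebra.TensorProduct.algHomOfLinearMapTensorProduct (linTensor f g)
      (fun a a' b b' => by
        rw [linTensor_tmul, linTensor_tmul, linTensor_tmul, map_mul, map_mul, opTensor_mul])
      (by
        change linTensor f g (1 ⊗ₜ[ℂ] 1) = 1
        rw [linTensor_tmul, map_one, map_one, opTensor_one]) with
    map_star' := linTensor_star f g }

theorem homTensor_tmul (f : R →⋆ₐ[ℂ] (H →L[ℂ] H)) (g : S →⋆ₐ[ℂ] (K →L[ℂ] K)) (a : R) (b : S) :
    homTensor f g (a ⊗ₜ[ℂ] b) = opTensor (f a) (g b) := rfl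

theorem norm_opTensor_le (S : H →L[ℂ] H) (T : K →L[ℂ] K) : ‖opTensor S T‖ ≤ ‖S‖ * ‖T‖ := by
  refine ContinuousLinearMap.opNorm_le_bound _ (by positivity) fun z => ?_
  refine denseRange_toHilbertTensor.induction_on z (by apply isClosed_le <;> fun_prop)
    fun z => ?_
  rw [opTensor_coe, LinearIsometry.norm_map, LinearIsometry.norm_map]
  exact ((TensorProduct.mapL S T).le_opNorm z).trans
    (mul_le_mul_of_nonneg_right (TensorProduct.norm_mapL_le S T) (norm_nonneg z))

theorem continuous_opTensor_right (S : H →L[ℂ] H) :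
    Continuous fun T : K →L[ℂ] K => opTensor S T :=
  AddMonoidHomClass.continuous_of_bound
    (AddMonoidHom.mk' (fun T : K →L[ℂ] K => opTensor S T) (opTensor_add_right S)) ‖S‖
    fun T => norm_opTensor_le S T

theorem continuous_opTensor_left (T : K →L[ℂ] K) :
    Continuous fun S : H →L[ℂ] H => opTensor S T :=
  AddMonoidHomClass.continuous_of_bound
    (AddMonoidHom.mk' (fun S : H →L[ℂ] H => opTensor S T) fun S S' => opTensor_add_left S S' T)
    ‖T‖ fun S => (norm_opTensor_le S T).trans (mul_comm _ _).le

end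

/-- The tensor product of two representations. -/
def Rep.tensor (π : Rep R) (ρ : Rep S) : Rep (R ⊗[ℂ] S) where
  H := HilbertTensor π.H ρ.H
  hom := homTensor π.hom ρ.hom

/-- Tensor products of pointwise bounded families of representations are pointwise bounded. -/
theorem bdd_tensor {ι : Type*} (π : ι → Rep R) (ρ : ι → Rep S)
    (hπ : ∀ x, BddAbove (Set.range fun i => ‖(π i).hom x‖))
    (hρ : ∀ x, BddAbove (Set.range fun i => ‖(ρ i).hom x‖)) (x : R ⊗[ℂ] S) :
    BddAbove (Set.range fun i => ‖((π i).tensor (ρ i)).hom x‖) := by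
  induction x using TensorProduct.induction_on with
  | zero => exact ⟨0, by rintro _ ⟨i, rfl⟩; simp⟩
  | tmul a b =>
    obtain ⟨c, hc⟩ := hπ a
    obtain ⟨d, hd⟩ := hρ b
    refine ⟨c * d, ?_⟩
    rintro _ ⟨i, rfl⟩
    have h1 := hc ⟨i, rfl⟩
    have h2 := hd ⟨i, rfl⟩
    exact (norm_opTensor_le _ _).trans
      (mul_le_mul h1 h2 (norm_nonneg _) ((norm_nonneg _).trans h1))
  | add x y hx hy =>
    obtain ⟨c, hc⟩ := hx
    obtain ⟨d, hd⟩ := hy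
    refine ⟨c + d, ?_⟩
    rintro _ ⟨i, rfl⟩
    have h1 := hc ⟨i, rfl⟩
    have h2 := hd ⟨i, rfl⟩
    simp only [map_add]
    exact (norm_add_le _ _).trans (add_le_add h1 h2)

theorem bdd_rep {A : Type u} [CStarAlgebra A] {ι : Type*} (π : ι → Rep A) (a : A) :
    BddAbove (Set.range fun i => ‖(π i).hom a‖) :=
  ⟨‖a‖, by rintro _ ⟨i, rfl⟩; exact NonUnitalStarAlgHom.norm_apply_le (π i).hom a⟩

end TensorRep

/-! ### Minimal tensor products -/

section MinTensor

variable (A B C : Type u) [CStarAlgebra A] [CStarAlgebra B] [CStarAlgebra C]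

/-- All tensor products `π ⊗ ρ` of representations of `A` and `B`. -/
def minFamily : RepFamily (A ⊗[ℂ] B) where
  index := Rep A × Rep B
  rep i := i.1.tensor i.2
  bdd := bdd_tensor _ _ (bdd_rep _) (bdd_rep _)

/-- The minimal (spatial) tensor product of two unital C*-algebras: the completion of the
algebraic tensor product in the norm `‖x‖ = sup ‖(π ⊗ ρ)(x)‖`, where `π` and `ρ` run over all
representations of `A` and `B` on Hilbert spaces. -/
def MinTensor : Type u := (minFamily A B).CStarCompletion

instance : CStarAlgebra (MinTensor A B) :=
  inferInstanceAs (CStarAlgebra (minFamily A B).CStarCompletion)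

/-- All tensor products `π ⊗ ρ ⊗ τ` of representations of `A`, `B` and `C`. -/
def minFamily₃ : RepFamily (A ⊗[ℂ] (B ⊗[ℂ] C)) where
  index := Rep A × Rep B × Rep C
  rep i := i.1.tensor (i.2.1.tensor i.2.2)
  bdd := bdd_tensor _ _ (bdd_rep _) (bdd_tensor _ _ (bdd_rep _) (bdd_rep _))

/-- The minimal (spatial) tensor product of three unital C*-algebras: the completion of the
algebraic tensor product in the norm `‖x‖ = sup ‖(π ⊗ ρ ⊗ τ)(x)‖`, where `π`, `ρ` and `τ` run over
all representations of `A`, `B` and `C`. It is canonically isomorphic to the iterated products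
`(A ⊗ B) ⊗ C` and `A ⊗ (B ⊗ C)` by the maps `ofLeft` and `ofRight` below. -/
def MinTensor₃ : Type u := (minFamily₃ A B C).CStarCompletion

instance : CStarAlgebra (MinTensor₃ A B C) :=
  inferInstanceAs (CStarAlgebra (minFamily₃ A B C).CStarCompletion)

end MinTensor


/-! ### Auxiliary unitaries between Hilbert space tensor products -/

section Unitaries

set_option linter.unusedSectionVars false

variable {H K L : Type u}
  [NormedAddCommGroup H] [InnerProductSpace ℂ H] [CompleteSpace H]
  [NormedAddCommGroup K] [InnerProductSpace ℂ K] [CompleteSpace K]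
  [NormedAddCommGroup L] [InnerProductSpace ℂ L] [CompleteSpace L]

/-- An operator that is intertwined with `T` by a unitary has the same norm as `T`. -/
theorem norm_le_of_intertwine (W : H ≃ₗᵢ[ℂ] K) {T : H →L[ℂ] H} {T' : K →L[ℂ] K}
    (h : ∀ x, T' (W x) = W (T x)) : ‖T'‖ ≤ ‖T‖ := by
  refine ContinuousLinearMap.opNorm_le_bound _ (norm_nonneg _) fun y => ?_
  obtain ⟨x, rfl⟩ := W.surjective y
  rw [h, W.norm_map, W.norm_map]
  exact T.le_opNorm x

theorem continuous_toHilbertTensor_tmul :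
    Continuous fun p : H × K => (toHilbertTensor (p.1 ⊗ₜ[ℂ] p.2) : HilbertTensor H K) :=
  toHilbertTensor.continuous.comp TensorProduct.continuous_tmul

/-- A property of vectors of a Hilbert space tensor product holds everywhere if it is closed,
additive and holds on elementary tensors with components from dense subsets. -/
theorem dense_induction {X Y : Type*} {e : X → H} {f : Y → K} (he : DenseRange e)
    (hf : DenseRange f) {p : HilbertTensor H K → Prop} (hp : IsClosed {z | p z}) (h0 : p 0)
    (hadd : ∀ z w, p z → p w → p (z + w))
    (h : ∀ x y, p (toHilbertTensor (e x ⊗ₜ[ℂ] f y))) (z : HilbertTensor H K) : p z := by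
  refine denseRange_toHilbertTensor.induction_on z hp fun z => ?_
  induction z using TensorProduct.induction_on with
  | zero => rwa [map_zero]
  | add x y hx hy => rw [map_add]; exact hadd _ _ hx hy
  | tmul x y =>
    have hd : DenseRange (Prod.map e f) := he.prodMap hf
    exact hd.induction_on (p := fun q : H × K => p (toHilbertTensor (q.1 ⊗ₜ[ℂ] q.2))) (x, y)
      (hp.preimage continuous_toHilbertTensor_tmul) fun q => h q.1 q.2

/-- The isometric embedding of `(H ⊗ K) ⊗ L` with dense range. -/
def embL : (H ⊗[ℂ] K) ⊗[ℂ] L →ₗᵢ[ℂ] HilbertTensor (HilbertTensor H K) L :=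
  toHilbertTensor.comp (TensorProduct.mapIsometry toHilbertTensor LinearIsometry.id)

/-- The isometric embedding of `H ⊗ (K ⊗ L)` with dense range. -/
def embR : H ⊗[ℂ] (K ⊗[ℂ] L) →ₗᵢ[ℂ] HilbertTensor H (HilbertTensor K L) :=
  toHilbertTensor.comp (TensorProduct.mapIsometry LinearIsometry.id toHilbertTensor)

theorem embL_add (x y : (H ⊗[ℂ] K) ⊗[ℂ] L) : embL (x + y) = embL x + embL y :=
  LinearIsometry.map_add embL x y

theorem embL_zero : embL (0 : (H ⊗[ℂ] K) ⊗[ℂ] L) = 0 := LinearIsometry.map_zero embL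

theorem embR_add (x y : H ⊗[ℂ] (K ⊗[ℂ] L)) : embR (x + y) = embR x + embR y :=
  LinearIsometry.map_add embR x y

theorem embR_zero : embR (0 : H ⊗[ℂ] (K ⊗[ℂ] L)) = 0 := LinearIsometry.map_zero embR

theorem denseRange_embL : DenseRange (embL : (H ⊗[ℂ] K) ⊗[ℂ] L →ₗᵢ[ℂ] _) := fun z =>
  dense_induction (p := fun z => z ∈ closure (Set.range embL)) denseRange_toHilbertTensor
    denseRange_id isClosed_closure (subset_closure ⟨0, embL_zero⟩)
    (fun _ _ hz hw => (embL : (H ⊗[ℂ] K) ⊗[ℂ] L →ₗᵢ[ℂ] _).toLinearMap.range.topologicalClosure.add_mem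
       hz hw)
    (fun x y => subset_closure ⟨x ⊗ₜ[ℂ] y, rfl⟩) z

theorem denseRange_embR : DenseRange (embR : H ⊗[ℂ] (K ⊗[ℂ] L) →ₗᵢ[ℂ] _) := fun z =>
  dense_induction (p := fun z => z ∈ closure (Set.range embR)) denseRange_id
    denseRange_toHilbertTensor isClosed_closure (subset_closure ⟨0, embR_zero⟩)
    (fun _ _ hz hw => (embR : H ⊗[ℂ] (K ⊗[ℂ] L) →ₗᵢ[ℂ] _).toLinearMap.range.topologicalClosure.add_mem
       hz hw)
    (fun x y => subset_closure ⟨x ⊗ₜ[ℂ] y, rfl⟩) z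

variable (H K L) in
/-- The associativity unitary. -/
def assocUnitary :
    HilbertTensor (HilbertTensor H K) L ≃ₗᵢ[ℂ] HilbertTensor H (HilbertTensor K L) :=
  (TensorProduct.assoc ℂ H K L).extendOfIsometry embL.toLinearMap embR.toLinearMap
    denseRange_embL denseRange_embR fun x =>
      (embR.norm_map _).trans ((TensorProduct.norm_assoc x).trans (embL.norm_map x).symm)

theorem assocUnitary_tmul (x : H) (y : K) (z : L) :
    assocUnitary H K L (toHilbertTensor (toHilbertTensor (x ⊗ₜ[ℂ] y) ⊗ₜ[ℂ] z)) =
      toHilbertTensor (x ⊗ₜ[ℂ] toHilbertTensor (y ⊗ₜ[ℂ] z)) :=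
  LinearEquiv.extendOfIsometry_eq (TensorProduct.assoc ℂ H K L) embL.toLinearMap
    embR.toLinearMap denseRange_embL denseRange_embR
    (fun x => (embR.norm_map _).trans ((TensorProduct.norm_assoc x).trans (embL.norm_map x).symm))
    ((x ⊗ₜ[ℂ] y) ⊗ₜ[ℂ] z)

variable (K L) in
/-- The flip unitary. -/
def flipUnitary : HilbertTensor K L ≃ₗᵢ[ℂ] HilbertTensor L K :=
  (TensorProduct.comm ℂ K L).extendOfIsometry toHilbertTensor.toLinearMap
    toHilbertTensor.toLinearMap denseRange_toHilbertTensor denseRange_toHilbertTensor fun x =>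
      (toHilbertTensor.norm_map _).trans
        ((TensorProduct.norm_comm x).trans (toHilbertTensor.norm_map x).symm)

theorem flipUnitary_tmul (x : K) (y : L) :
    flipUnitary K L (toHilbertTensor (x ⊗ₜ[ℂ] y)) = toHilbertTensor (y ⊗ₜ[ℂ] x) :=
  LinearEquiv.extendOfIsometry_eq (TensorProduct.comm ℂ K L) toHilbertTensor.toLinearMap
    toHilbertTensor.toLinearMap denseRange_toHilbertTensor denseRange_toHilbertTensor
    (fun x => (toHilbertTensor.norm_map _).trans
      ((TensorProduct.norm_comm x).trans (toHilbertTensor.norm_map x).symm)) (x ⊗ₜ[ℂ] y)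

variable (H) in
/-- The unitary `1 ⊗ V`. -/
def lUnitary (V : K ≃ₗᵢ[ℂ] L) : HilbertTensor H K ≃ₗᵢ[ℂ] HilbertTensor H L :=
  (TensorProduct.congrIsometry (LinearIsometryEquiv.refl ℂ H) V).toLinearEquiv.extendOfIsometry
    toHilbertTensor.toLinearMap
    toHilbertTensor.toLinearMap denseRange_toHilbertTensor denseRange_toHilbertTensor fun x =>
      (toHilbertTensor.norm_map _).trans
        ((LinearIsometryEquiv.norm_map _ x).trans (toHilbertTensor.norm_map x).symm)

theorem lUnitary_tmul (V : K ≃ₗᵢ[ℂ] L) (x : H) (y : K) :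
    lUnitary H V (toHilbertTensor (x ⊗ₜ[ℂ] y)) = toHilbertTensor (x ⊗ₜ[ℂ] V y) :=
  LinearEquiv.extendOfIsometry_eq
    (TensorProduct.congrIsometry (LinearIsometryEquiv.refl ℂ H) V).toLinearEquiv
    toHilbertTensor.toLinearMap
    toHilbertTensor.toLinearMap denseRange_toHilbertTensor denseRange_toHilbertTensor
    (fun x => (toHilbertTensor.norm_map _).trans
        ((LinearIsometryEquiv.norm_map _ x).trans (toHilbertTensor.norm_map x).symm)) (x ⊗ₜ[ℂ] y)

theorem assocUnitary_opTensor (S : H →L[ℂ] H) (T : K →L[ℂ] K) (U : L →L[ℂ] L)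
    (v : HilbertTensor (HilbertTensor H K) L) :
    opTensor S (opTensor T U) (assocUnitary H K L v) =
      assocUnitary H K L (opTensor (opTensor S T) U v) := by
  refine denseRange_embL.induction_on v (isClosed_eq (by fun_prop) (by fun_prop)) fun v => ?_
  induction v using TensorProduct.induction_on with
  | zero => simp only [embL_zero, map_zero]
  | add x y hx hy => simp only [map_add, hx, hy]
  | tmul w z =>
    induction w using TensorProduct.induction_on with
    | zero => simp only [TensorProduct.zero_tmul, embL_zero, map_zero]
    | add x y hx hy => simp only [TensorProduct.add_tmul, map_add, hx, hy]
    | tmul x y =>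
      change opTensor S (opTensor T U)
        (assocUnitary H K L (toHilbertTensor (toHilbertTensor (x ⊗ₜ[ℂ] y) ⊗ₜ[ℂ] z))) =
        assocUnitary H K L (opTensor (opTensor S T) U
          (toHilbertTensor (toHilbertTensor (x ⊗ₜ[ℂ] y) ⊗ₜ[ℂ] z)))
      simp only [assocUnitary_tmul, opTensor_tmul]

theorem flipUnitary_opTensor (T : K →L[ℂ] K) (U : L →L[ℂ] L) (v : HilbertTensor K L) :
    opTensor U T (flipUnitary K L v) = flipUnitary K L (opTensor T U v) :=
  dense_induction denseRange_id denseRange_id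
    (p := fun v => opTensor U T (flipUnitary K L v) = flipUnitary K L (opTensor T U v))
    (isClosed_eq (by fun_prop) (by fun_prop)) (by simp)
    (fun x y hx hy => by simp only [map_add, hx, hy])
    (fun x y => by simp only [id, flipUnitary_tmul, opTensor_tmul]) v

theorem lUnitary_opTensor (V : K ≃ₗᵢ[ℂ] L) (S : H →L[ℂ] H) {T : K →L[ℂ] K} {T' : L →L[ℂ] L}
    (hV : ∀ x, T' (V x) = V (T x)) (v : HilbertTensor H K) :
    opTensor S T' (lUnitary H V v) = lUnitary H V (opTensor S T v) :=
  dense_induction denseRange_id denseRange_id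
    (p := fun v => opTensor S T' (lUnitary H V v) = lUnitary H V (opTensor S T v))
    (isClosed_eq (by fun_prop) (by fun_prop)) (by simp)
    (fun x y hx hy => by simp only [map_add, hx, hy])
    (fun x y => by simp only [id, lUnitary_tmul, opTensor_tmul, hV]) v

end Unitaries

/-! ### Canonical maps between minimal tensor products -/

section Maps

/-- The `*`-homomorphism out of an algebraic tensor product given by two `*`-homomorphisms with
commuting ranges, `a ⊗ b ↦ f(a) g(b)`. -/
def algLift {R S T : Type u} [Ring R] [StarRing R] [Algebra ℂ R] [StarModule ℂ R]
    [Ring S] [StarRing S] [Algebra ℂ S] [StarModule ℂ S]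
    [Ring T] [StarRing T] [Algebra ℂ T]
    (f : R →⋆ₐ[ℂ] T) (g : S →⋆ₐ[ℂ] T) (h : ∀ a b, Commute (f a) (g b)) :
    R ⊗[ℂ] S →⋆ₐ[ℂ] T :=
  { Algebra.TensorProduct.lift f.toAlgHom g.toAlgHom h with
    map_star' := fun x => by
      change Algebra.TensorProduct.lift f.toAlgHom g.toAlgHom h (star x) =
        star (Algebra.TensorProduct.lift f.toAlgHom g.toAlgHom h x)
      induction x using TensorProduct.induction_on with
      | zero => simp
      | add x y hx hy => rw [star_add, map_add, map_add, star_add, hx, hy]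
      | tmul a b =>
        rw [TensorProduct.star_tmul, Algebra.TensorProduct.lift_tmul,
          Algebra.TensorProduct.lift_tmul]
        change f (star a) * g (star b) = star (f a * g b)
        rw [(h _ _).eq, map_star, map_star, star_mul] }

theorem algLift_tmul {R S T : Type u} [Ring R] [StarRing R] [Algebra ℂ R] [StarModule ℂ R]
    [Ring S] [StarRing S] [Algebra ℂ S] [StarModule ℂ S]
    [Ring T] [StarRing T] [Algebra ℂ T]
    (f : R →⋆ₐ[ℂ] T) (g : S →⋆ₐ[ℂ] T) (h : ∀ a b, Commute (f a) (g b)) (a : R) (b : S) :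
    algLift f g h (a ⊗ₜ[ℂ] b) = f a * g b := rfl

/-- The inclusion `a ↦ a ⊗ 1` into an algebraic tensor product. -/
def algInl (R S : Type u) [Ring R] [StarRing R] [Algebra ℂ R] [StarModule ℂ R]
    [Ring S] [StarRing S] [Algebra ℂ S] [StarModule ℂ S] : R →⋆ₐ[ℂ] R ⊗[ℂ] S :=
  { (Algebra.TensorProduct.includeLeft : R →ₐ[ℂ] R ⊗[ℂ] S) with
    map_star' := fun a => by
      change star a ⊗ₜ[ℂ] (1 : S) = star (a ⊗ₜ[ℂ] (1 : S))
      rw [TensorProduct.star_tmul, star_one] }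

/-- The inclusion `b ↦ 1 ⊗ b` into an algebraic tensor product. -/
def algInr (R S : Type u) [Ring R] [StarRing R] [Algebra ℂ R] [StarModule ℂ R]
    [Ring S] [StarRing S] [Algebra ℂ S] [StarModule ℂ S] : S →⋆ₐ[ℂ] R ⊗[ℂ] S :=
  { (Algebra.TensorProduct.includeRight : S →ₐ[ℂ] R ⊗[ℂ] S) with
    map_star' := fun b => by
      change (1 : R) ⊗ₜ[ℂ] star b = star ((1 : R) ⊗ₜ[ℂ] b)
      rw [TensorProduct.star_tmul, star_one] }

theorem algInl_apply {R S : Type u} [Ring R] [StarRing R] [Algebra ℂ R] [StarModule ℂ R]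
    [Ring S] [StarRing S] [Algebra ℂ S] [StarModule ℂ S] (a : R) :
    algInl R S a = a ⊗ₜ[ℂ] 1 := rfl

theorem algInr_apply {R S : Type u} [Ring R] [StarRing R] [Algebra ℂ R] [StarModule ℂ R]
    [Ring S] [StarRing S] [Algebra ℂ S] [StarModule ℂ S] (b : S) :
    algInr R S b = 1 ⊗ₜ[ℂ] b := rfl

theorem continuous_starAlgHom {A B : Type*} [CStarAlgebra A] [CStarAlgebra B]
    (f : A →⋆ₐ[ℂ] B) : Continuous f :=
  AddMonoidHomClass.continuous_of_bound f 1
    fun x => by simpa using NonUnitalStarAlgHom.norm_apply_le f x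

variable {A B C A' B' : Type u} [CStarAlgebra A] [CStarAlgebra B] [CStarAlgebra C]
  [CStarAlgebra A'] [CStarAlgebra B']

/-- The canonical map from the algebraic to the minimal tensor product. -/
def MinTensor.ofAlg (A B : Type u) [CStarAlgebra A] [CStarAlgebra B] :
    A ⊗[ℂ] B →⋆ₐ[ℂ] MinTensor A B := (minFamily A B).ofAlg

/-- The extension of `π ⊗ ρ` to the minimal tensor product. -/
def MinTensor.eval (π : Rep A) (ρ : Rep B) :
    MinTensor A B →⋆ₐ[ℂ] (HilbertTensor π.H ρ.H →L[ℂ] HilbertTensor π.H ρ.H) :=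
  (minFamily A B).extendRep (π, ρ)

theorem MinTensor.denseRange_ofAlg : DenseRange (MinTensor.ofAlg A B) :=
  (minFamily A B).denseRange_ofAlg

theorem MinTensor.eval_ofAlg (π : Rep A) (ρ : Rep B) (x : A ⊗[ℂ] B) :
    MinTensor.eval π ρ (MinTensor.ofAlg A B x) = homTensor π.hom ρ.hom x :=
  (minFamily A B).lift_ofAlg _ _ x

theorem MinTensor.norm_le {t : MinTensor A B} {c : ℝ} (hc : 0 ≤ c)
    (h : ∀ π ρ, ‖MinTensor.eval π ρ t‖ ≤ c) : ‖t‖ ≤ c :=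
  (minFamily A B).norm_le_of_extendRep hc fun i => h i.1 i.2

theorem norm_homTensor_le (π : Rep A) (ρ : Rep B) (x : A ⊗[ℂ] B) :
    ‖homTensor π.hom ρ.hom x‖ ≤ (minFamily A B).seminorm x :=
  (minFamily A B).le_seminorm (π, ρ) x

/-- The inclusion `a ↦ a ⊗ 1` into the minimal tensor product. -/
def MinTensor.inl (A B : Type u) [CStarAlgebra A] [CStarAlgebra B] : A →⋆ₐ[ℂ] MinTensor A B :=
  (MinTensor.ofAlg A B).comp (algInl A B)

/-- The inclusion `b ↦ 1 ⊗ b` into the minimal tensor product. -/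
def MinTensor.inr (A B : Type u) [CStarAlgebra A] [CStarAlgebra B] : B →⋆ₐ[ℂ] MinTensor A B :=
  (MinTensor.ofAlg A B).comp (algInr A B)

/-- The algebraic tensor product of two unital `*`-homomorphisms. -/
def algMap (f : A →⋆ₐ[ℂ] A') (g : B →⋆ₐ[ℂ] B') : A ⊗[ℂ] B →⋆ₐ[ℂ] A' ⊗[ℂ] B' :=
  algLift ((algInl A' B').comp f) ((algInr A' B').comp g) fun a b => by
    change (f a ⊗ₜ[ℂ] (1 : B')) * ((1 : A') ⊗ₜ[ℂ] g b) =
      ((1 : A') ⊗ₜ[ℂ] g b) * (f a ⊗ₜ[ℂ] (1 : B'))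
    simp

theorem algMap_tmul (f : A →⋆ₐ[ℂ] A') (g : B →⋆ₐ[ℂ] B') (a : A) (b : B) :
    algMap f g (a ⊗ₜ[ℂ] b) = f a ⊗ₜ[ℂ] g b := by
  change (f a ⊗ₜ[ℂ] (1 : B')) * ((1 : A') ⊗ₜ[ℂ] g b) = _
  simp

theorem homTensor_algMap (f : A →⋆ₐ[ℂ] A') (g : B →⋆ₐ[ℂ] B') (π : Rep A') (ρ : Rep B')
    (x : A ⊗[ℂ] B) : homTensor π.hom ρ.hom (algMap f g x) =
      homTensor (π.hom.comp f) (ρ.hom.comp g) x := by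
  induction x using TensorProduct.induction_on with
  | zero => rw [map_zero, map_zero, map_zero]
  | add x y hx hy => rw [map_add, map_add, hx, hy, map_add]
  | tmul a b =>
    rw [algMap_tmul, homTensor_tmul, homTensor_tmul]
    rfl

/-- The tensor product `f ⊗ g` of two unital `*`-homomorphisms on minimal tensor products. -/
def MinTensor.map (f : A →⋆ₐ[ℂ] A') (g : B →⋆ₐ[ℂ] B') : MinTensor A B →⋆ₐ[ℂ] MinTensor A' B' :=
  (minFamily A B).lift ((MinTensor.ofAlg A' B').comp (algMap f g)) fun x =>
    MinTensor.norm_le ((minFamily A B).seminorm_nonneg x) fun π ρ => by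
      rw [StarAlgHom.comp_apply, MinTensor.eval_ofAlg, homTensor_algMap]
      exact norm_homTensor_le ⟨π.H, π.hom.comp f⟩ ⟨ρ.H, ρ.hom.comp g⟩ x

theorem MinTensor.map_tmul (f : A →⋆ₐ[ℂ] A') (g : B →⋆ₐ[ℂ] B') (a : A) (b : B) :
    MinTensor.map f g (MinTensor.ofAlg A B (a ⊗ₜ[ℂ] b)) =
      MinTensor.ofAlg A' B' (f a ⊗ₜ[ℂ] g b) := by
  refine ((minFamily A B).lift_ofAlg _ _ _).trans ?_
  rw [StarAlgHom.comp_apply, algMap_tmul]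

/-- The canonical map from the algebraic to the minimal tensor product of three algebras. -/
def MinTensor₃.ofAlg (A B C : Type u) [CStarAlgebra A] [CStarAlgebra B] [CStarAlgebra C] :
    A ⊗[ℂ] (B ⊗[ℂ] C) →⋆ₐ[ℂ] MinTensor₃ A B C := (minFamily₃ A B C).ofAlg

/-- The extension of `π ⊗ ρ ⊗ τ` to the minimal tensor product. -/
def MinTensor₃.eval (π : Rep A) (ρ : Rep B) (τ : Rep C) :
    MinTensor₃ A B C →⋆ₐ[ℂ] (HilbertTensor π.H (HilbertTensor ρ.H τ.H) →L[ℂ]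
      HilbertTensor π.H (HilbertTensor ρ.H τ.H)) :=
  (minFamily₃ A B C).extendRep (π, ρ, τ)

theorem MinTensor₃.denseRange_ofAlg : DenseRange (MinTensor₃.ofAlg A B C) :=
  (minFamily₃ A B C).denseRange_ofAlg

theorem MinTensor₃.eval_ofAlg (π : Rep A) (ρ : Rep B) (τ : Rep C) (x : A ⊗[ℂ] (B ⊗[ℂ] C)) :
    MinTensor₃.eval π ρ τ (MinTensor₃.ofAlg A B C x) =
      homTensor π.hom (homTensor ρ.hom τ.hom) x :=
  (minFamily₃ A B C).lift_ofAlg _ _ x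

theorem MinTensor₃.norm_le {t : MinTensor₃ A B C} {c : ℝ} (hc : 0 ≤ c)
    (h : ∀ π ρ τ, ‖MinTensor₃.eval π ρ τ t‖ ≤ c) : ‖t‖ ≤ c :=
  (minFamily₃ A B C).norm_le_of_extendRep hc fun i => h i.1 i.2.1 i.2.2

theorem norm_homTensor₃_le (π : Rep A) (ρ : Rep B) (τ : Rep C) (x : A ⊗[ℂ] (B ⊗[ℂ] C)) :
    ‖homTensor π.hom (homTensor ρ.hom τ.hom) x‖ ≤ (minFamily₃ A B C).seminorm x :=
  (minFamily₃ A B C).le_seminorm (π, ρ, τ) x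

/-! #### The canonical map `A ⊗ (B ⊗ C) → A ⊗ B ⊗ C` -/

/-- The inclusion `a ↦ a ⊗ 1 ⊗ 1` of `A` into `A ⊗ B ⊗ C`. -/
def MinTensor₃.inA (A B C : Type u) [CStarAlgebra A] [CStarAlgebra B] [CStarAlgebra C] :
    A →⋆ₐ[ℂ] MinTensor₃ A B C :=
  (MinTensor₃.ofAlg A B C).comp (algInl A (B ⊗[ℂ] C))

theorem MinTensor₃.inA_apply (a : A) :
    MinTensor₃.inA A B C a = MinTensor₃.ofAlg A B C (a ⊗ₜ[ℂ] 1) := rfl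

/-- The inclusion `y ↦ 1 ⊗ y` of `B ⊗ C` into `A ⊗ B ⊗ C`. -/
def MinTensor₃.inBC (A B C : Type u) [CStarAlgebra A] [CStarAlgebra B] [CStarAlgebra C] :
    MinTensor B C →⋆ₐ[ℂ] MinTensor₃ A B C :=
  (minFamily B C).lift ((MinTensor₃.ofAlg A B C).comp (algInr A (B ⊗[ℂ] C))) fun y =>
    MinTensor₃.norm_le ((minFamily B C).seminorm_nonneg y) fun π ρ τ => by
      rw [StarAlgHom.comp_apply, MinTensor₃.eval_ofAlg, algInr_apply, homTensor_tmul, map_one]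
      refine (norm_opTensor_le _ _).trans ?_
      refine (mul_le_mul_of_nonneg_right ContinuousLinearMap.norm_id_le (norm_nonneg _)).trans ?_
      rw [one_mul]
      exact norm_homTensor_le ρ τ y

theorem MinTensor₃.inBC_ofAlg (y : B ⊗[ℂ] C) :
    MinTensor₃.inBC A B C (MinTensor.ofAlg B C y) = MinTensor₃.ofAlg A B C (1 ⊗ₜ[ℂ] y) :=
  (minFamily B C).lift_ofAlg _ _ y

theorem MinTensor₃.inA_mul_inBC_ofAlg (a : A) (y : B ⊗[ℂ] C) :
    MinTensor₃.inA A B C a * MinTensor₃.inBC A B C (MinTensor.ofAlg B C y) =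
      MinTensor₃.ofAlg A B C (a ⊗ₜ[ℂ] y) := by
  rw [MinTensor₃.inBC_ofAlg, MinTensor₃.inA_apply, ← map_mul,
    Algebra.TensorProduct.tmul_mul_tmul, one_mul, mul_one]

theorem MinTensor₃.commute_inA_inBC (a : A) (t : MinTensor B C) :
    Commute (MinTensor₃.inA A B C a) (MinTensor₃.inBC A B C t) := by
  refine MinTensor.denseRange_ofAlg.induction_on
    (p := fun t => MinTensor₃.inA A B C a * MinTensor₃.inBC A B C t =
      MinTensor₃.inBC A B C t * MinTensor₃.inA A B C a) t
    (isClosed_eq (continuous_const.mul (continuous_starAlgHom _))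
      ((continuous_starAlgHom _).mul continuous_const)) fun y => ?_
  rw [MinTensor₃.inA_mul_inBC_ofAlg, MinTensor₃.inBC_ofAlg, MinTensor₃.inA_apply, ← map_mul,
    Algebra.TensorProduct.tmul_mul_tmul, one_mul, mul_one]

theorem MinTensor₃.eval_inA_mul_inBC (π : Rep A) (ρ : Rep B) (τ : Rep C) (a : A)
    (t : MinTensor B C) :
    MinTensor₃.eval π ρ τ (MinTensor₃.inA A B C a * MinTensor₃.inBC A B C t) =
      opTensor (π.hom a) (MinTensor.eval ρ τ t) := by
  refine MinTensor.denseRange_ofAlg.induction_on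
    (p := fun t => MinTensor₃.eval π ρ τ (MinTensor₃.inA A B C a * MinTensor₃.inBC A B C t) =
      opTensor (π.hom a) (MinTensor.eval ρ τ t)) t
    (isClosed_eq ((continuous_starAlgHom _).comp (continuous_const.mul (continuous_starAlgHom _)))
      ((continuous_opTensor_right _).comp (continuous_starAlgHom _))) fun y => ?_
  rw [MinTensor₃.inA_mul_inBC_ofAlg, MinTensor₃.eval_ofAlg, MinTensor.eval_ofAlg, homTensor_tmul]

theorem MinTensor₃.eval_algLift_right (π : Rep A) (ρ : Rep B) (τ : Rep C)
    (x : A ⊗[ℂ] MinTensor B C) :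
    MinTensor₃.eval π ρ τ (algLift (MinTensor₃.inA A B C) (MinTensor₃.inBC A B C)
      MinTensor₃.commute_inA_inBC x) = homTensor π.hom (MinTensor.eval ρ τ) x := by
  induction x using TensorProduct.induction_on with
  | zero => rw [map_zero, map_zero, map_zero]
  | add x y hx hy => rw [map_add, map_add, hx, hy, map_add]
  | tmul a t => rw [algLift_tmul, homTensor_tmul, MinTensor₃.eval_inA_mul_inBC]

/-- The canonical map `A ⊗ (B ⊗ C) → A ⊗ B ⊗ C`, `a ⊗ (b ⊗ c) ↦ a ⊗ b ⊗ c`. -/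
def MinTensor₃.ofRight (A B C : Type u) [CStarAlgebra A] [CStarAlgebra B] [CStarAlgebra C] :
    MinTensor A (MinTensor B C) →⋆ₐ[ℂ] MinTensor₃ A B C :=
  (minFamily A (MinTensor B C)).lift
    (algLift (MinTensor₃.inA A B C) (MinTensor₃.inBC A B C) MinTensor₃.commute_inA_inBC) fun x =>
    MinTensor₃.norm_le (RepFamily.seminorm_nonneg _ x) fun π ρ τ => by
      rw [MinTensor₃.eval_algLift_right]
      exact norm_homTensor_le π ⟨HilbertTensor ρ.H τ.H, MinTensor.eval ρ τ⟩ x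

theorem MinTensor₃.ofRight_tmul (a : A) (y : B ⊗[ℂ] C) :
    MinTensor₃.ofRight A B C (MinTensor.ofAlg _ _ (a ⊗ₜ[ℂ] MinTensor.ofAlg B C y)) =
      MinTensor₃.ofAlg A B C (a ⊗ₜ[ℂ] y) := by
  refine (RepFamily.lift_ofAlg _ _ _ _).trans ?_
  rw [algLift_tmul, MinTensor₃.inA_mul_inBC_ofAlg]

/-! #### The canonical map `(A ⊗ B) ⊗ C → A ⊗ B ⊗ C` -/

/-- The inclusion `a ⊗ b ↦ a ⊗ b ⊗ 1` of the algebraic tensor product of `A` and `B` into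
`A ⊗ B ⊗ C`. -/
def MinTensor₃.algInAB (A B C : Type u) [CStarAlgebra A] [CStarAlgebra B] [CStarAlgebra C] :
    A ⊗[ℂ] B →⋆ₐ[ℂ] MinTensor₃ A B C :=
  (MinTensor₃.ofAlg A B C).comp (algLift (algInl A (B ⊗[ℂ] C))
    ((algInr A (B ⊗[ℂ] C)).comp (algInl B C)) fun a b => by
      change (a ⊗ₜ[ℂ] (1 : B ⊗[ℂ] C)) * ((1 : A) ⊗ₜ[ℂ] (b ⊗ₜ[ℂ] (1 : C))) =
        ((1 : A) ⊗ₜ[ℂ] (b ⊗ₜ[ℂ] (1 : C))) * (a ⊗ₜ[ℂ] (1 : B ⊗[ℂ] C))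
      simp)

theorem MinTensor₃.algInAB_tmul (a : A) (b : B) :
    MinTensor₃.algInAB A B C (a ⊗ₜ[ℂ] b) =
      MinTensor₃.ofAlg A B C (a ⊗ₜ[ℂ] (b ⊗ₜ[ℂ] 1)) := by
  rw [MinTensor₃.algInAB, StarAlgHom.comp_apply, algLift_tmul, StarAlgHom.comp_apply,
    algInl_apply, algInl_apply, algInr_apply, Algebra.TensorProduct.tmul_mul_tmul, one_mul,
    mul_one]

theorem MinTensor₃.eval_algInAB (π : Rep A) (ρ : Rep B) (τ : Rep C) (x : A ⊗[ℂ] B)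
    (v : HilbertTensor (HilbertTensor π.H ρ.H) τ.H) :
    MinTensor₃.eval π ρ τ (MinTensor₃.algInAB A B C x) (assocUnitary π.H ρ.H τ.H v) =
      assocUnitary π.H ρ.H τ.H (opTensor (homTensor π.hom ρ.hom x) 1 v) := by
  induction x using TensorProduct.induction_on with
  | zero =>
    have h : opTensor (0 : HilbertTensor π.H ρ.H →L[ℂ] _) (1 : τ.H →L[ℂ] τ.H) = 0 := by
      simpa using opTensor_smul_left 0 (0 : HilbertTensor π.H ρ.H →L[ℂ] _) (1 : τ.H →L[ℂ] τ.H)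
    rw [map_zero, map_zero, map_zero, h]
    simp
  | add x y hx hy =>
    rw [map_add, map_add, map_add, opTensor_add_left, add_apply,
      add_apply, hx, hy, map_add]
  | tmul a b =>
    rw [MinTensor₃.algInAB_tmul, MinTensor₃.eval_ofAlg, homTensor_tmul, homTensor_tmul,
      homTensor_tmul, map_one, assocUnitary_opTensor]

/-- The inclusion `x ↦ x ⊗ 1` of `A ⊗ B` into `A ⊗ B ⊗ C`. -/
def MinTensor₃.inAB (A B C : Type u) [CStarAlgebra A] [CStarAlgebra B] [CStarAlgebra C] :
    MinTensor A B →⋆ₐ[ℂ] MinTensor₃ A B C :=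
  (minFamily A B).lift (MinTensor₃.algInAB A B C) fun x =>
    MinTensor₃.norm_le (RepFamily.seminorm_nonneg _ x) fun π ρ τ => by
      refine (norm_le_of_intertwine _ (MinTensor₃.eval_algInAB π ρ τ x)).trans ?_
      refine (norm_opTensor_le _ _).trans ?_
      refine (mul_le_mul_of_nonneg_left ContinuousLinearMap.norm_id_le (norm_nonneg _)).trans ?_
      rw [mul_one]
      exact norm_homTensor_le π ρ x

theorem MinTensor₃.inAB_ofAlg (x : A ⊗[ℂ] B) :
    MinTensor₃.inAB A B C (MinTensor.ofAlg A B x) = MinTensor₃.algInAB A B C x :=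
  (minFamily A B).lift_ofAlg _ _ x

/-- The inclusion `c ↦ 1 ⊗ 1 ⊗ c` of `C` into `A ⊗ B ⊗ C`. -/
def MinTensor₃.inC (A B C : Type u) [CStarAlgebra A] [CStarAlgebra B] [CStarAlgebra C] :
    C →⋆ₐ[ℂ] MinTensor₃ A B C :=
  (MinTensor₃.ofAlg A B C).comp ((algInr A (B ⊗[ℂ] C)).comp (algInr B C))

theorem MinTensor₃.inC_apply (c : C) :
    MinTensor₃.inC A B C c = MinTensor₃.ofAlg A B C (1 ⊗ₜ[ℂ] (1 ⊗ₜ[ℂ] c)) := rfl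

theorem MinTensor₃.commute_inAB_inC (t : MinTensor A B) (c : C) :
    Commute (MinTensor₃.inAB A B C t) (MinTensor₃.inC A B C c) := by
  refine MinTensor.denseRange_ofAlg.induction_on
    (p := fun t => MinTensor₃.inAB A B C t * MinTensor₃.inC A B C c =
      MinTensor₃.inC A B C c * MinTensor₃.inAB A B C t) t
    (isClosed_eq ((continuous_starAlgHom _).mul continuous_const)
      (continuous_const.mul (continuous_starAlgHom _))) fun y => ?_
  rw [MinTensor₃.inAB_ofAlg, MinTensor₃.inC_apply]
  induction y using TensorProduct.induction_on with
  | zero => rw [map_zero, zero_mul, mul_zero]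
  | add x y hx hy => rw [map_add, add_mul, mul_add, hx, hy]
  | tmul a b =>
    rw [MinTensor₃.algInAB_tmul, ← map_mul, ← map_mul]
    simp

theorem MinTensor₃.eval_inAB (π : Rep A) (ρ : Rep B) (τ : Rep C) (t : MinTensor A B)
    (v : HilbertTensor (HilbertTensor π.H ρ.H) τ.H) :
    MinTensor₃.eval π ρ τ (MinTensor₃.inAB A B C t) (assocUnitary π.H ρ.H τ.H v) =
      assocUnitary π.H ρ.H τ.H (opTensor (MinTensor.eval π ρ t) 1 v) := by
  have h1 : Continuous fun t => MinTensor₃.eval π ρ τ (MinTensor₃.inAB A B C t) :=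
    (continuous_starAlgHom (MinTensor₃.eval π ρ τ)).comp
      (continuous_starAlgHom (MinTensor₃.inAB A B C))
  have h2 : Continuous fun t => opTensor (MinTensor.eval π ρ t) (1 : τ.H →L[ℂ] τ.H) :=
    (continuous_opTensor_left 1).comp (continuous_starAlgHom (MinTensor.eval π ρ))
  refine MinTensor.denseRange_ofAlg.induction_on
    (p := fun t => MinTensor₃.eval π ρ τ (MinTensor₃.inAB A B C t) (assocUnitary π.H ρ.H τ.H v) =
      assocUnitary π.H ρ.H τ.H (opTensor (MinTensor.eval π ρ t) 1 v)) t
    (isClosed_eq (h1.clm_apply continuous_const)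
      ((assocUnitary π.H ρ.H τ.H).continuous.comp (h2.clm_apply continuous_const))) fun y => ?_
  rw [MinTensor₃.inAB_ofAlg, MinTensor₃.eval_algInAB, MinTensor.eval_ofAlg]

theorem MinTensor₃.eval_algLift_left (π : Rep A) (ρ : Rep B) (τ : Rep C)
    (x : MinTensor A B ⊗[ℂ] C) (v : HilbertTensor (HilbertTensor π.H ρ.H) τ.H) :
    MinTensor₃.eval π ρ τ (algLift (MinTensor₃.inAB A B C) (MinTensor₃.inC A B C)
        MinTensor₃.commute_inAB_inC x) (assocUnitary π.H ρ.H τ.H v) =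
      assocUnitary π.H ρ.H τ.H (homTensor (MinTensor.eval π ρ) τ.hom x v) := by
  induction x using TensorProduct.induction_on with
  | zero => rw [map_zero, map_zero, map_zero]; simp
  | add x y hx hy =>
    rw [map_add, map_add, map_add, add_apply,
      add_apply, hx, hy, map_add]
  | tmul t c =>
    have h : opTensor (MinTensor.eval π ρ t) (τ.hom c) =
        opTensor (MinTensor.eval π ρ t) 1 * opTensor 1 (τ.hom c) := by
      rw [← opTensor_mul, one_mul, mul_one]
    have h1 : (1 : HilbertTensor π.H ρ.H →L[ℂ] _) = opTensor 1 1 := opTensor_one.symm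
    rw [algLift_tmul, homTensor_tmul, h, map_mul, mul_apply_eq_comp,
      mul_apply_eq_comp, ← MinTensor₃.eval_inAB, MinTensor₃.inC_apply,
      MinTensor₃.eval_ofAlg, homTensor_tmul, homTensor_tmul, map_one, map_one,
      assocUnitary_opTensor, opTensor_one]

/-- The canonical map `(A ⊗ B) ⊗ C → A ⊗ B ⊗ C`, `(a ⊗ b) ⊗ c ↦ a ⊗ b ⊗ c`. -/
def MinTensor₃.ofLeft (A B C : Type u) [CStarAlgebra A] [CStarAlgebra B] [CStarAlgebra C] :
    MinTensor (MinTensor A B) C →⋆ₐ[ℂ] MinTensor₃ A B C :=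
  (minFamily (MinTensor A B) C).lift
    (algLift (MinTensor₃.inAB A B C) (MinTensor₃.inC A B C) MinTensor₃.commute_inAB_inC) fun x =>
    MinTensor₃.norm_le (RepFamily.seminorm_nonneg _ x) fun π ρ τ =>
      (norm_le_of_intertwine _ (MinTensor₃.eval_algLift_left π ρ τ x)).trans
        (norm_homTensor_le ⟨HilbertTensor π.H ρ.H, MinTensor.eval π ρ⟩ τ x)

theorem MinTensor₃.ofLeft_tmul (a : A) (b : B) (c : C) :
    MinTensor₃.ofLeft A B C (MinTensor.ofAlg _ _ (MinTensor.ofAlg A B (a ⊗ₜ[ℂ] b) ⊗ₜ[ℂ] c)) =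
      MinTensor₃.ofAlg A B C (a ⊗ₜ[ℂ] (b ⊗ₜ[ℂ] c)) := by
  refine (RepFamily.lift_ofAlg _ _ _ _).trans ?_
  rw [algLift_tmul, MinTensor₃.inAB_ofAlg, MinTensor₃.algInAB_tmul, MinTensor₃.inC_apply,
    ← map_mul]
  simp

/-! #### The flip of the last two factors -/

/-- The flip of an algebraic tensor product. -/
def algFlip (B C : Type u) [CStarAlgebra B] [CStarAlgebra C] : B ⊗[ℂ] C →⋆ₐ[ℂ] C ⊗[ℂ] B :=
  algLift (algInr C B) (algInl C B) fun b c => by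
    change ((1 : C) ⊗ₜ[ℂ] b) * (c ⊗ₜ[ℂ] (1 : B)) = (c ⊗ₜ[ℂ] (1 : B)) * ((1 : C) ⊗ₜ[ℂ] b)
    simp

theorem algFlip_tmul (b : B) (c : C) : algFlip B C (b ⊗ₜ[ℂ] c) = c ⊗ₜ[ℂ] b := by
  change ((1 : C) ⊗ₜ[ℂ] b) * (c ⊗ₜ[ℂ] (1 : B)) = _
  simp

/-- `1 ⊗ σ` on the algebraic tensor product of three algebras. -/
def algFlip₂₃ (A B C : Type u) [CStarAlgebra A] [CStarAlgebra B] [CStarAlgebra C] :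
    A ⊗[ℂ] (B ⊗[ℂ] C) →⋆ₐ[ℂ] A ⊗[ℂ] (C ⊗[ℂ] B) :=
  algLift (algInl A (C ⊗[ℂ] B)) ((algInr A (C ⊗[ℂ] B)).comp (algFlip B C)) fun a y => by
    change (a ⊗ₜ[ℂ] (1 : C ⊗[ℂ] B)) * ((1 : A) ⊗ₜ[ℂ] algFlip B C y) =
      ((1 : A) ⊗ₜ[ℂ] algFlip B C y) * (a ⊗ₜ[ℂ] (1 : C ⊗[ℂ] B))
    simp

theorem algFlip₂₃_tmul (a : A) (y : B ⊗[ℂ] C) :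
    algFlip₂₃ A B C (a ⊗ₜ[ℂ] y) = a ⊗ₜ[ℂ] algFlip B C y := by
  change (a ⊗ₜ[ℂ] (1 : C ⊗[ℂ] B)) * ((1 : A) ⊗ₜ[ℂ] algFlip B C y) = _
  simp

theorem homTensor_algFlip (ρ : Rep C) (τ : Rep B) (y : B ⊗[ℂ] C) (v : HilbertTensor τ.H ρ.H) :
    homTensor ρ.hom τ.hom (algFlip B C y) (flipUnitary τ.H ρ.H v) =
      flipUnitary τ.H ρ.H (homTensor τ.hom ρ.hom y v) := by
  induction y using TensorProduct.induction_on with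
  | zero => rw [map_zero, map_zero, map_zero]; simp
  | add x y hx hy =>
    rw [map_add, map_add, map_add, add_apply,
      add_apply, hx, hy, map_add]
  | tmul b c => rw [algFlip_tmul, homTensor_tmul, homTensor_tmul, flipUnitary_opTensor]

theorem homTensor_algFlip₂₃ (π : Rep A) (ρ : Rep C) (τ : Rep B) (x : A ⊗[ℂ] (B ⊗[ℂ] C))
    (v : HilbertTensor π.H (HilbertTensor τ.H ρ.H)) :
    homTensor π.hom (homTensor ρ.hom τ.hom) (algFlip₂₃ A B C x)
        (lUnitary π.H (flipUnitary τ.H ρ.H) v) =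
      lUnitary π.H (flipUnitary τ.H ρ.H) (homTensor π.hom (homTensor τ.hom ρ.hom) x v) := by
  induction x using TensorProduct.induction_on with
  | zero => rw [map_zero, map_zero, map_zero]; simp
  | add x y hx hy =>
    rw [map_add, map_add, map_add, add_apply,
      add_apply, hx, hy, map_add]
  | tmul a y =>
    rw [algFlip₂₃_tmul, homTensor_tmul, homTensor_tmul]
    exact lUnitary_opTensor _ _ (homTensor_algFlip ρ τ y) v

/-- The map `id ⊗ σ : A ⊗ B ⊗ C → A ⊗ C ⊗ B`, where `σ` is the flip `b ⊗ c ↦ c ⊗ b`. -/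
def MinTensor₃.flip₂₃ (A B C : Type u) [CStarAlgebra A] [CStarAlgebra B] [CStarAlgebra C] :
    MinTensor₃ A B C →⋆ₐ[ℂ] MinTensor₃ A C B :=
  (minFamily₃ A B C).lift ((MinTensor₃.ofAlg A C B).comp (algFlip₂₃ A B C)) fun x =>
    MinTensor₃.norm_le (RepFamily.seminorm_nonneg _ x) fun π ρ τ => by
      rw [StarAlgHom.comp_apply, MinTensor₃.eval_ofAlg]
      exact (norm_le_of_intertwine _ (homTensor_algFlip₂₃ π ρ τ x)).trans
        (norm_homTensor₃_le π τ ρ x)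

theorem MinTensor₃.flip₂₃_tmul (a : A) (b : B) (c : C) :
    MinTensor₃.flip₂₃ A B C (MinTensor₃.ofAlg A B C (a ⊗ₜ[ℂ] (b ⊗ₜ[ℂ] c))) =
      MinTensor₃.ofAlg A C B (a ⊗ₜ[ℂ] (c ⊗ₜ[ℂ] b)) := by
  refine (RepFamily.lift_ofAlg _ _ _ _).trans ?_
  rw [StarAlgHom.comp_apply, algFlip₂₃_tmul, algFlip_tmul]

end Maps

/-! ### Quantum families of maps -/

section QuantumFamily

/-- A quantum family of maps `X → Y` parametrized by `D`: a unital `*`-homomorphism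
`C(Y) → C(X) ⊗ C(D)`. A compact quantum space is given by its unital C*-algebra. -/
abbrev QuantumFamily (X Y D : Type u) [CStarAlgebra X] [CStarAlgebra Y] [CStarAlgebra D] :
    Type u := Y →⋆ₐ[ℂ] MinTensor X D

variable {X Y X₁ X₂ X₃ D D₁ D₂ M E : Type u} [CStarAlgebra X] [CStarAlgebra Y]
  [CStarAlgebra X₁] [CStarAlgebra X₂] [CStarAlgebra X₃] [CStarAlgebra D]
  [CStarAlgebra D₁] [CStarAlgebra D₂] [CStarAlgebra M] [CStarAlgebra E]

/-- The map `id ⊗ Λ : C(X) ⊗ C(E) → C(X) ⊗ C(D)` composed with a quantum family `Φ`. -/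
def reparametrize (Φ : QuantumFamily X Y E) (Λ : E →⋆ₐ[ℂ] D) : QuantumFamily X Y D :=
  (MinTensor.map (StarAlgHom.id ℂ X) Λ).comp Φ

/-- The composition `Ψ₁ △ Ψ₂ = (Ψ₁ ⊗ id) ∘ Ψ₂ : C(X₃) → C(X₁) ⊗ C(D₁) ⊗ C(D₂)`. -/
def composition (Ψ₁ : QuantumFamily X₁ X₂ D₁) (Ψ₂ : QuantumFamily X₂ X₃ D₂) :
    X₃ →⋆ₐ[ℂ] MinTensor₃ X₁ D₁ D₂ :=
  (MinTensor₃.ofLeft X₁ D₁ D₂).comp ((MinTensor.map Ψ₁ (StarAlgHom.id ℂ D₂)).comp Ψ₂)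

/-- Two quantum families of maps `M → M` commute if
`(id ⊗ σ) ∘ (Ψ₁ △ Ψ₂) = Ψ₂ △ Ψ₁`, where `σ` is the flip. -/
def Commuting (Ψ₁ : QuantumFamily M M D₁) (Ψ₂ : QuantumFamily M M D₂) : Prop :=
  (MinTensor₃.flip₂₃ M D₁ D₂).comp (composition Ψ₁ Ψ₂) = composition Ψ₂ Ψ₁

/-- `Φ` is the quantum family of all maps `X → Y`. -/
def IsFamilyOfAllMaps (Φ : QuantumFamily X Y E) : Prop :=
  ∀ (P : Type u) [CStarAlgebra P] (Θ : QuantumFamily X Y P),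
    ∃! Λ : E →⋆ₐ[ℂ] P, reparametrize Φ Λ = Θ

/-- Every quantum family commuting with `Ψ` arises from `Φ` in a unique way. -/
def IsUniversalCommuting (Ψ : QuantumFamily M M D) (Φ : QuantumFamily M M E) : Prop :=
  ∀ (P : Type u) [CStarAlgebra P] (Θ : QuantumFamily M M P), Commuting Θ Ψ →
    ∃! Λ : E →⋆ₐ[ℂ] P, reparametrize Φ Λ = Θ

/-! ### Compact quantum semigroups -/

/-- Coassociativity `(Δ ⊗ id) ∘ Δ = (id ⊗ Δ) ∘ Δ`, as maps into `C(E) ⊗ C(E) ⊗ C(E)`. -/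
def IsCoassociative (Δ : E →⋆ₐ[ℂ] MinTensor E E) : Prop :=
  (MinTensor₃.ofLeft E E E).comp ((MinTensor.map Δ (StarAlgHom.id ℂ E)).comp Δ) =
    (MinTensor₃.ofRight E E E).comp ((MinTensor.map (StarAlgHom.id ℂ E) Δ).comp Δ)

/-- The C*-algebra of complex numbers, lifted to an arbitrary universe. -/
abbrev Scalars : Type u := ULift.{u} ℂ

instance : StarRing Scalars.{u} where
  star z := ⟨star z.down⟩
  star_involutive z := ULift.ext _ _ (star_star z.down)
  star_mul z w := ULift.ext _ _ (star_mul z.down w.down)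
  star_add z w := ULift.ext _ _ (star_add z.down w.down)

instance : CStarRing Scalars.{u} where
  norm_mul_self_le z := CStarRing.norm_mul_self_le z.down

instance : StarModule ℂ Scalars.{u} where
  star_smul c z := ULift.ext _ _ (star_smul c z.down)

instance : CStarAlgebra Scalars.{u} where

/-- The identification of the complex numbers with `Scalars`. -/
def toScalars : ℂ →⋆ₐ[ℂ] Scalars.{u} where
  toFun z := ⟨z⟩
  map_one' := rfl
  map_mul' _ _ := rfl
  map_zero' := rfl
  map_add' _ _ := rfl
  commutes' _ := rfl
  map_star' _ := rfl

/-- The character `ε` is a counit: `(ε ⊗ id) ∘ Δ = id = (id ⊗ ε) ∘ Δ`, where `C(E)` is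
identified with `ℂ ⊗ C(E)` by `a ↦ 1 ⊗ a` and with `C(E) ⊗ ℂ` by `a ↦ a ⊗ 1`. -/
def IsCounit (Δ : E →⋆ₐ[ℂ] MinTensor E E) (ε : E →⋆ₐ[ℂ] ℂ) : Prop :=
  (MinTensor.map (toScalars.{u}.comp ε) (StarAlgHom.id ℂ E)).comp Δ =
      MinTensor.inr Scalars.{u} E ∧
    (MinTensor.map (StarAlgHom.id ℂ E) (toScalars.{u}.comp ε)).comp Δ =
      MinTensor.inl E Scalars.{u}

/-- `Δ` is the comultiplication of a compact quantum semigroup with unit. -/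
def IsQuantumSemigroupWithUnit (Δ : E →⋆ₐ[ℂ] MinTensor E E) : Prop :=
  IsCoassociative Δ ∧ ∃ ε : E →⋆ₐ[ℂ] ℂ, IsCounit Δ ε

/-- `Φ △ Φ = (id ⊗ Δ) ∘ Φ`: the relation that determines the comultiplication on the quantum
space of all maps. -/
def IsCompositionComul (Φ : QuantumFamily M M E) (Δ : E →⋆ₐ[ℂ] MinTensor E E) : Prop :=
  composition Φ Φ = (MinTensor₃.ofRight M E E).comp (reparametrize Φ Δ)

end QuantumFamily

end QuantumFamilies

end

open QuantumFamilies

/-!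
In coordinates, everything in the theorem becomes a statement about matrices. Fix a basis `b` of
the finite-dimensional algebra `M`. A quantum family `Ψ : M → M ⊗ D` is determined by its
coefficients `d_ij ∈ D`, where `Ψ(b_j) = ∑_i b_i ⊗ d_ij` (`coeff`), reparametrization applies a
homomorphism entrywise, and composition is matrix multiplication with values in the tensor product
(`composition_eq_iff`). A family with coefficients `t_ij` commutes with `Ψ` if and only if the
matrix `t` commutes with the scalar matrix `φ(d_ij)` for every vector functional `φ` on `D`
(`commuting_iff_slice`). Hence the commuting families are closed under reparametrization and
composition, and contain the family of identity maps.

To make coordinates available, slice maps `φ ⊗ id` have to be bounded on the minimal tensor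
product, and those of vector functionals have to separate points. Both facts come from matrix
coefficients of representations `π ⊗ ρ`, together with the Gelfand-Naimark theorem
(`norm_le_of_forall_rep`), proved here with the GNS construction for norming states. On `M` every
functional is a combination of vector functionals, so every element of `M ⊗ B` has coordinates.

The algebra of `U` is the completion of the free `*`-algebra on symbols `u_ij` with respect to all
representations for which the matrix of the `u_ij` is the coefficient matrix of a quantum family
commuting with `Ψ`. These representations are uniformly bounded on generators, because quantum
families are contractive. No relations have to be written down: the linear map
`b_j ↦ ∑_i b_i ⊗ u_ij` is multiplicative and `*`-preserving because the defining representations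
separate the points of `U` (`exists_quantumFamily_of_separating`), and the universal property holds
because a commuting family over `P`, followed by a representation of `P`, gives one of the defining
representations (`isUniversalCommuting_of_coeff`).

The comultiplication is induced by the composition of the universal family with itself and the
counit by the family of identity maps, so that `Δ(u_ij) = ∑_k u_ik ⊗ u_kj` and `ε(u_ij) = δ_ij`;
the axioms are checked at the `u_ij`. The map from the algebra of all maps `M → M` to that of `U`
hits the generators, and it is surjective because `*`-homomorphisms of C*-algebras have closed range
(`isClosed_range_starAlgHom`).
-/

noncomputable section

namespace QuantumFamilies

/-! ### States and the Gelfand-Naimark theorem -/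

section States

open scoped ComplexOrder

variable {A : Type u} [CStarAlgebra A]

/-- A unital functional of norm at most one is real on self-adjoint elements: the estimate
`|g(a + it)|² ≤ ‖a‖² + t²` for all real `t` leaves no room for an imaginary part. -/
theorem im_apply_eq_zero_of_norm_le_one {g : A →L[ℂ] ℂ} (hg : ‖g‖ ≤ 1) (hg1 : g 1 = 1) {a : A}
    (ha : IsSelfAdjoint a) : (g a).im = 0 := by
  have key : ∀ t : ℝ, 2 * t * (g a).im ≤ ‖a‖ ^ 2 := fun t => by
    set z : ℂ := t * Complex.I with hz
    have h1 : g (a + z • 1) = g a + z := by rw [map_add, map_smul, hg1, smul_eq_mul, mul_one]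
    have h2 : star (a + z • (1 : A)) * (a + z • 1) = a * a + ((t : ℂ) ^ 2) • 1 := by
      have hI : Complex.I * Complex.I = -1 := Complex.I_mul_I
      have hs : star z = -z := by simp [hz]
      rw [star_add, star_smul, star_one, ha.star_eq, hs]
      simp only [add_mul, mul_add, neg_smul, smul_mul_assoc, one_mul, mul_smul_comm, mul_one,
        smul_add, smul_neg, smul_smul, neg_mul]
      have hzz : z * z = -(t : ℂ) ^ 2 := by rw [hz]; linear_combination (t : ℂ) ^ 2 * hI
      rw [hzz, neg_smul]
      abel
    have h3 : ‖a + z • (1 : A)‖ ^ 2 ≤ ‖a‖ ^ 2 + t ^ 2 := by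
      rw [pow_two, ← CStarRing.norm_star_mul_self, h2]
      refine (norm_add_le _ _).trans (add_le_add ?_ ?_)
      · rw [pow_two]; exact norm_mul_le _ _
      · rw [norm_smul]
        have : ‖(1 : A)‖ ≤ 1 := by
          rcases subsingleton_or_nontrivial A with h | h
          · rw [Subsingleton.elim (1 : A) 0, norm_zero]; exact zero_le_one
          · exact CStarRing.norm_one.le
        have h := mul_le_mul_of_nonneg_left this (sq_nonneg t)
        simpa using h
    have h4 : ‖g a + z‖ ≤ ‖a + z • (1 : A)‖ := by
      rw [← h1]
      exact (g.le_opNorm _).trans (mul_le_of_le_one_left (norm_nonneg _) hg)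
    have h5 : ‖g a + z‖ ^ 2 = (g a).re ^ 2 + ((g a).im + t) ^ 2 := by
      rw [← Complex.normSq_eq_norm_sq, Complex.normSq_apply]
      simp [hz, pow_two]
    have h6 := pow_le_pow_left₀ (norm_nonneg _) h4 2
    nlinarith [sq_nonneg (g a).re, sq_nonneg (g a).im]
  by_contra h
  -- This `t` makes the left-hand side of `key` equal to `‖a‖² + 1`.
  have := key ((‖a‖ ^ 2 + 1) / (2 * (g a).im))
  rw [show 2 * ((‖a‖ ^ 2 + 1) / (2 * (g a).im)) * (g a).im = ‖a‖ ^ 2 + 1 by field_simp] at this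
  linarith

/-- A unital functional of norm at most one is positive, since `‖‖a‖ - a‖ ≤ ‖a‖` for `0 ≤ a`. -/
theorem apply_nonneg_of_norm_le_one [PartialOrder A] [StarOrderedRing A] {g : A →L[ℂ] ℂ}
    (hg : ‖g‖ ≤ 1) (hg1 : g 1 = 1) {a : A} (ha : 0 ≤ a) : 0 ≤ g a := by
  have him := im_apply_eq_zero_of_norm_le_one hg hg1 (IsSelfAdjoint.of_nonneg ha)
  rw [Complex.nonneg_iff]
  refine ⟨?_, him.symm⟩
  have h1 : ‖algebraMap ℝ A ‖a‖ - a‖ ≤ ‖a‖ := by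
    have h0 : 0 ≤ algebraMap ℝ A ‖a‖ - a :=
      sub_nonneg.2 (IsSelfAdjoint.of_nonneg ha).le_algebraMap_norm_self
    rw [CStarAlgebra.norm_le_iff_le_algebraMap _ (norm_nonneg a) h0]
    exact sub_le_self _ ha
  have h2 : g (algebraMap ℝ A ‖a‖ - a) = (‖a‖ : ℂ) - g a := by
    rw [map_sub, Algebra.algebraMap_eq_smul_one, ← Complex.coe_smul, map_smul, hg1, smul_eq_mul,
      mul_one]
  have h3 : ‖(‖a‖ : ℂ) - g a‖ ≤ ‖a‖ := by
    rw [← h2]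
    exact (g.le_opNorm _).trans ((mul_le_of_le_one_left (norm_nonneg _) hg).trans h1)
  have h4 := (Complex.re_le_norm _).trans h3
  simp at h4
  exact h4

/-- A norming state for a positive element: the character of the generated commutative
C*-algebra at the top of the spectrum, extended by the Hahn-Banach theorem. -/
theorem exists_norming_functional [Nontrivial A] [PartialOrder A] [StarOrderedRing A] {h : A}
    (hh : 0 ≤ h) : ∃ g : A →L[ℂ] ℂ, ‖g‖ ≤ 1 ∧ g 1 = 1 ∧ g h = ‖h‖ := by
  have hsa := IsSelfAdjoint.of_nonneg hh
  have : IsStarNormal h := hsa.isStarNormal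
  let S := StarAlgebra.elemental ℂ h
  have hmem : (‖h‖ : ℂ) ∈ spectrum ℂ h := by
    have := spectrum.algebraMap_mem ℂ (CStarAlgebra.norm_mem_spectrum_of_nonneg hh)
    simpa using this
  have hmem' : (‖h‖ : ℂ) ∈ spectrum ℂ (⟨h, StarAlgebra.elemental.self_mem ℂ h⟩ : S) := by
    rwa [StarSubalgebra.spectrum_eq (hS := StarAlgebra.elemental.isClosed ℂ h)]
  obtain ⟨φ, hφ⟩ := WeakDual.CharacterSpace.mem_spectrum_iff_exists.1 hmem'
  let f : S →L[ℂ] ℂ := WeakDual.CharacterSpace.toCLM φ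
  have hf : ‖f‖ ≤ 1 := by
    refine f.opNorm_le_bound zero_le_one fun x => ?_
    rw [one_mul]
    exact spectrum.norm_le_norm_of_mem (AlgHom.apply_mem_spectrum φ x)
  obtain ⟨g, hg, hgn⟩ := exists_extension_norm_eq S.toSubalgebra.toSubmodule f
  refine ⟨g, hgn.trans_le hf, ?_, ?_⟩
  · exact (hg (1 : S)).trans (map_one φ)
  · exact (hg ⟨h, StarAlgebra.elemental.self_mem ℂ h⟩).trans hφ

/-- The Gelfand-Naimark theorem: the norm of a C*-algebra is recovered by its representations. -/
theorem norm_le_of_forall_rep {a : A} {c : ℝ} (hc : 0 ≤ c)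
    (h : ∀ π : Rep A, ‖π.hom a‖ ≤ c) : ‖a‖ ≤ c := by
  rcases subsingleton_or_nontrivial A with hA | hA
  · rwa [Subsingleton.elim a 0, norm_zero]
  let : PartialOrder A := CStarAlgebra.spectralOrder A
  have : StarOrderedRing A := CStarAlgebra.spectralOrderedRing A
  obtain ⟨g, hg, hg1, hga⟩ := exists_norming_functional (star_mul_self_nonneg a)
  -- In the GNS representation of `g`, the cyclic vector `Ω` satisfies `‖π(a) Ω‖² = g(a⋆a) = ‖a‖²`.
  let f : A →ₚ[ℂ] ℂ := PositiveLinearMap.mk₀ (g : A →ₗ[ℂ] ℂ)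
    fun x hx => apply_nonneg_of_norm_le_one hg hg1 hx
  have hf : ∀ x, f x = g x := fun _ => rfl
  let π : Rep A := ⟨f.GNS, f.gnsStarAlgHom⟩
  let Ω : f.PreGNS := f.toPreGNS 1
  have hΩ : ‖(Ω : f.GNS)‖ = 1 := by
    rw [UniformSpace.Completion.norm_coe, PositiveLinearMap.preGNS_norm_def]
    simp [Ω, hf, hg1]
  have hπΩ : ‖π.hom a (Ω : f.GNS)‖ = ‖a‖ := by
    change ‖f.gnsNonUnitalStarAlgHom a (Ω : f.GNS)‖ = ‖a‖
    rw [PositiveLinearMap.gnsNonUnitalStarAlgHom_apply_coe, UniformSpace.Completion.norm_coe,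
      PositiveLinearMap.preGNS_norm_def]
    simp [Ω, hf, hga, CStarRing.norm_star_mul_self]
  calc ‖a‖ = ‖π.hom a (Ω : f.GNS)‖ := hπΩ.symm
    _ ≤ ‖π.hom a‖ * ‖(Ω : f.GNS)‖ := ContinuousLinearMap.le_opNorm _ _
    _ ≤ c := by rw [hΩ, mul_one]; exact h π

theorem eq_zero_of_forall_rep {a : A} (h : ∀ π : Rep A, π.hom a = 0) : a = 0 :=
  norm_le_zero_iff.1 (norm_le_of_forall_rep le_rfl fun π => by rw [h, norm_zero])

end States

/-! ### Ranges of `*`-homomorphisms -/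

section ClosedRange

variable {A B : Type u} [CStarAlgebra A] [CStarAlgebra B]

open scoped ComplexStarModule

theorem map_realPart (f : A →⋆ₐ[ℂ] B) (x : A) : f (ℜ x : A) = ℜ (f x) := by
  rw [realPart_apply_coe, realPart_apply_coe, ← Complex.coe_smul, ← Complex.coe_smul, map_smul,
    map_add, map_star]

theorem map_imaginaryPart (f : A →⋆ₐ[ℂ] B) (x : A) : f (ℑ x : A) = ℑ (f x) := by
  rw [imaginaryPart_apply_coe, imaginaryPart_apply_coe, ← Complex.coe_smul, ← Complex.coe_smul,
    map_smul, map_smul, map_sub, map_star]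

/-- Self-adjoint elements of the range of a `*`-homomorphism lift without increase of the norm,
by truncating any self-adjoint lift with the continuous functional calculus. -/
theorem exists_preimage_norm_le_of_isSelfAdjoint (f : A →⋆ₐ[ℂ] B) {a : A} (ha : IsSelfAdjoint a) :
    ∃ x, f x = f a ∧ ‖x‖ ≤ ‖f a‖ := by
  have hfa : IsSelfAdjoint (f a) := ha.map f
  -- The truncation `t` is the identity on the spectrum of `f a`.
  let t : ℝ → ℝ := fun s => max (-‖f a‖) (min ‖f a‖ s)
  have ht : Continuous t := by fun_prop
  refine ⟨cfc t a, ?_, ?_⟩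
  · have h1 : f (cfc t a) = cfc t (f a) :=
      StarAlgHomClass.map_cfc f t a ht.continuousOn (continuous_starAlgHom f) ha hfa
    rw [h1]
    conv_rhs => rw [← cfc_id' ℝ (f a) hfa]
    refine cfc_congr fun s hs => ?_
    have hs' : |s| ≤ ‖f a‖ := by
      rcases subsingleton_or_nontrivial B with hB | hB
      · exact absurd hs (by simp [spectrum.of_subsingleton])
      · simpa using spectrum.norm_le_norm_of_mem hs
    rw [abs_le] at hs'
    simp only [t]
    rw [min_eq_right hs'.2, max_eq_right hs'.1]
  · refine norm_cfc_le (norm_nonneg _) fun s _ => ?_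
    rw [Real.norm_eq_abs, abs_le]
    have := norm_nonneg (f a)
    exact ⟨le_max_left _ _, max_le (by linarith) (min_le_left _ _)⟩

/-- The range of a `*`-homomorphism between C*-algebras is closed: norm-controlled lifts exist on
the range, hence on its closure, by summing series. -/
theorem isClosed_range_starAlgHom (f : A →⋆ₐ[ℂ] B) : IsClosed (Set.range f) := by
  let F : NormedAddGroupHom A B := AddMonoidHom.mkNormedAddGroupHom (f : A →+ B) 1
    fun x => by simpa using NonUnitalStarAlgHom.norm_apply_le f x
  have h : F.SurjectiveOnWith F.range 2 := by
    rintro _ ⟨x, rfl⟩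
    change ∃ g, f g = f x ∧ ‖g‖ ≤ 2 * ‖f x‖
    obtain ⟨a, ha, ha'⟩ := exists_preimage_norm_le_of_isSelfAdjoint f (ℜ x).2
    obtain ⟨b, hb, hb'⟩ := exists_preimage_norm_le_of_isSelfAdjoint f (ℑ x).2
    refine ⟨a + Complex.I • b, ?_, ?_⟩
    · rw [map_add, map_smul, ha, hb, ← map_smul, ← map_add, realPart_add_I_smul_imaginaryPart]
    · rw [map_realPart] at ha'
      rw [map_imaginaryPart] at hb'
      have h1 := ha'.trans (realPart.norm_le (f x))
      have h2 := hb'.trans (imaginaryPart.norm_le (f x))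
      refine (norm_add_le _ _).trans ?_
      rw [norm_smul, Complex.norm_I, one_mul, two_mul]
      exact add_le_add h1 h2
  have h' := controlled_closure_of_complete (f := F) two_pos one_pos h
  refine isClosed_of_closure_subset fun y hy => ?_
  obtain ⟨x, hx, -⟩ := h' y hy
  exact ⟨x, hx⟩

end ClosedRange

/-! ### Slice maps -/

section Slices

variable {A B B' C : Type u} [CStarAlgebra A] [CStarAlgebra B] [CStarAlgebra B'] [CStarAlgebra C]

/-- The slice map `φ ⊗ id : a ⊗ b ↦ φ(a) b` on the algebraic tensor product. -/
def algSlice (φ : A →ₗ[ℂ] ℂ) (B : Type u) [CStarAlgebra B] : A ⊗[ℂ] B →ₗ[ℂ] B :=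
  (TensorProduct.lid ℂ B).toLinearMap ∘ₗ LinearMap.rTensor B φ

theorem algSlice_tmul (φ : A →ₗ[ℂ] ℂ) (a : A) (b : B) :
    algSlice φ B (a ⊗ₜ[ℂ] b) = φ a • b := by simp [algSlice]

/-- A functional is sliceable if its slice maps are bounded on minimal tensor products, with a
bound that does not depend on the second factor. -/
def IsSliceable (φ : A →ₗ[ℂ] ℂ) : Prop :=
  ∃ C : ℝ, ∀ (B : Type u) [CStarAlgebra B] (x : A ⊗[ℂ] B),
    ‖algSlice φ B x‖ ≤ C * ‖MinTensor.ofAlg A B x‖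

/-- The slice map `φ ⊗ id : A ⊗ B → B` on the minimal tensor product, the continuous extension of
`algSlice`. It is meaningful for sliceable functionals only, and a junk value otherwise. -/
def slice (φ : A →ₗ[ℂ] ℂ) (B : Type u) [CStarAlgebra B] : MinTensor A B →L[ℂ] B :=
  (algSlice φ B).extendOfNorm (MinTensor.ofAlg A B).toAlgHom.toLinearMap

namespace IsSliceable

variable {φ : A →ₗ[ℂ] ℂ}

theorem slice_ofAlg (hφ : IsSliceable φ) (x : A ⊗[ℂ] B) :
    slice φ B (MinTensor.ofAlg A B x) = algSlice φ B x :=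
  LinearMap.extendOfNorm_eq (e := (MinTensor.ofAlg A B).toAlgHom.toLinearMap)
    MinTensor.denseRange_ofAlg (hφ.imp fun _ hC => hC B) x

theorem slice_tmul (hφ : IsSliceable φ) (a : A) (b : B) :
    slice φ B (MinTensor.ofAlg A B (a ⊗ₜ[ℂ] b)) = φ a • b := by
  rw [hφ.slice_ofAlg, algSlice_tmul]

theorem exists_norm_slice_le (hφ : IsSliceable φ) :
    ∃ C : ℝ, ∀ (B : Type u) [CStarAlgebra B] (x : MinTensor A B),
    ‖slice φ B x‖ ≤ C * ‖x‖ :=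
  hφ.imp fun C hC B _ x =>
    LinearMap.norm_extendOfNorm_apply_le (e := (MinTensor.ofAlg A B).toAlgHom.toLinearMap)
      MinTensor.denseRange_ofAlg C (hC B) x

theorem slice_map (hφ : IsSliceable φ) (g : B →⋆ₐ[ℂ] B') (x : MinTensor A B) :
    slice φ B' (MinTensor.map (StarAlgHom.id ℂ A) g x) = g (slice φ B x) := by
  refine MinTensor.denseRange_ofAlg.induction_on
    (p := fun x => slice φ B' (MinTensor.map (StarAlgHom.id ℂ A) g x) = g (slice φ B x)) x
    (isClosed_eq ((slice φ B').continuous.comp (continuous_starAlgHom _))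
      ((continuous_starAlgHom _).comp (slice φ B).continuous)) fun x => ?_
  induction x using TensorProduct.induction_on with
  | zero => simp
  | add x y hx hy => simp only [map_add, hx, hy]
  | tmul a b => rw [MinTensor.map_tmul, hφ.slice_tmul, hφ.slice_tmul, map_smul]; rfl

end IsSliceable

/-- The functional `a ↦ ⟨ξ, π(a) η⟩` given by two vectors of a representation. -/
def vectorFunctional (π : Rep A) (ξ η : π.H) : A →ₗ[ℂ] ℂ :=
  (innerSL ℂ ξ).toLinearMap ∘ₗ (ContinuousLinearMap.apply ℂ π.H η).toLinearMap ∘ₗ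
    π.hom.toAlgHom.toLinearMap

theorem vectorFunctional_apply (π : Rep A) (ξ η : π.H) (a : A) :
    vectorFunctional π ξ η a = inner ℂ ξ (π.hom a η) := rfl

/-- Matrix coefficients of `π ⊗ ρ` at elementary tensors are matrix coefficients of `ρ` at slices.
-/
theorem inner_homTensor (π : Rep A) (ρ : Rep B) (ξ η : π.H) (ζ ω : ρ.H) (x : A ⊗[ℂ] B) :
    inner ℂ (toHilbertTensor (ξ ⊗ₜ[ℂ] ζ))
        (homTensor π.hom ρ.hom x (toHilbertTensor (η ⊗ₜ[ℂ] ω))) =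
      inner ℂ ζ (ρ.hom (algSlice (vectorFunctional π ξ η) B x) ω) := by
  induction x using TensorProduct.induction_on with
  | zero => simp
  | add x y hx hy => simp only [map_add, add_apply, inner_add_right, hx, hy]
  | tmul a b =>
    rw [homTensor_tmul, opTensor_tmul, LinearIsometry.inner_map_map, TensorProduct.inner_tmul,
      algSlice_tmul, map_smul, smul_apply, inner_smul_right,
      vectorFunctional_apply]

/-- The slice map of `⟨ξ, π(·) η⟩` is bounded by `‖ξ‖ ‖η‖`. The bound is checked in every
representation of `B`, which suffices by the Gelfand-Naimark theorem. -/
theorem isSliceable_vectorFunctional (π : Rep A) (ξ η : π.H) :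
    IsSliceable (vectorFunctional π ξ η) := by
  refine ⟨‖ξ‖ * ‖η‖, fun B _ x => norm_le_of_forall_rep (by positivity) fun ρ => ?_⟩
  refine ContinuousLinearMap.opNorm_le_bound _ (by positivity) fun ω => ?_
  set ζ := ρ.hom (algSlice (vectorFunctional π ξ η) B x) ω
  have h1 : ‖ζ‖ * ‖ζ‖ ≤ ‖ζ‖ * (‖ξ‖ * ‖η‖ * ‖MinTensor.ofAlg A B x‖ * ‖ω‖) := by
    calc ‖ζ‖ * ‖ζ‖ = ‖inner ℂ ζ ζ‖ := by
          rw [inner_self_eq_norm_sq_to_K, norm_pow, pow_two]; simp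
      _ = ‖inner ℂ (toHilbertTensor (ξ ⊗ₜ[ℂ] ζ))
            (MinTensor.eval π ρ (MinTensor.ofAlg A B x) (toHilbertTensor (η ⊗ₜ[ℂ] ω)))‖ := by
          rw [MinTensor.eval_ofAlg, inner_homTensor]
      _ ≤ ‖toHilbertTensor (ξ ⊗ₜ[ℂ] ζ)‖ *
            (‖MinTensor.ofAlg A B x‖ * ‖toHilbertTensor (η ⊗ₜ[ℂ] ω)‖) := by
          refine (norm_inner_le_norm _ _).trans (mul_le_mul_of_nonneg_left ?_ (norm_nonneg _))
          exact (ContinuousLinearMap.le_opNorm _ _).trans (mul_le_mul_of_nonneg_right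
            (NonUnitalStarAlgHom.norm_apply_le _ _) (norm_nonneg _))
      _ = _ := by
          rw [LinearIsometry.norm_map, LinearIsometry.norm_map, TensorProduct.norm_tmul,
            TensorProduct.norm_tmul]
          ring
  rcases (norm_nonneg ζ).eq_or_lt with h0 | h0
  · rw [← h0]; positivity
  · exact le_of_mul_le_mul_left h1 h0

theorem inner_eval (π : Rep A) (ρ : Rep B) (ξ η : π.H) (ζ ω : ρ.H) (x : MinTensor A B) :
    inner ℂ (toHilbertTensor (ξ ⊗ₜ[ℂ] ζ))
        (MinTensor.eval π ρ x (toHilbertTensor (η ⊗ₜ[ℂ] ω))) =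
      inner ℂ ζ (ρ.hom (slice (vectorFunctional π ξ η) B x) ω) := by
  have h1 := continuous_starAlgHom (MinTensor.eval π ρ)
  have h2 := (continuous_starAlgHom ρ.hom).comp (slice (vectorFunctional π ξ η) B).continuous
  refine MinTensor.denseRange_ofAlg.induction_on
    (p := fun x => inner ℂ (toHilbertTensor (ξ ⊗ₜ[ℂ] ζ))
        (MinTensor.eval π ρ x (toHilbertTensor (η ⊗ₜ[ℂ] ω))) =
      inner ℂ ζ (ρ.hom (slice (vectorFunctional π ξ η) B x) ω)) x
    (isClosed_eq (continuous_const.inner (h1.clm_apply continuous_const))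
      (continuous_const.inner (h2.clm_apply continuous_const))) fun x => ?_
  rw [MinTensor.eval_ofAlg, inner_homTensor,
    (isSliceable_vectorFunctional π ξ η).slice_ofAlg]

/-- An operator on a Hilbert space tensor product vanishes if its matrix coefficients at
elementary tensors do. -/
theorem operator_eq_zero_of_inner_tmul {H K : Type u} [NormedAddCommGroup H]
    [InnerProductSpace ℂ H] [CompleteSpace H] [NormedAddCommGroup K] [InnerProductSpace ℂ K]
    [CompleteSpace K] {T : HilbertTensor H K →L[ℂ] HilbertTensor H K}
    (h : ∀ ξ η ζ ω, inner ℂ (toHilbertTensor (ξ ⊗ₜ[ℂ] ζ)) (T (toHilbertTensor (η ⊗ₜ[ℂ] ω))) = 0) :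
    T = 0 := by
  refine opTensor_ext fun η ω => ?_
  rw [zero_apply]
  set v := T (toHilbertTensor (η ⊗ₜ[ℂ] ω))
  have hv : ∀ w : HilbertTensor H K, inner ℂ w v = 0 :=
    dense_induction denseRange_id denseRange_id (isClosed_eq (by fun_prop) (by fun_prop))
      (inner_zero_left _) (fun z w hz hw => by rw [inner_add_left, hz, hw, add_zero])
      fun ξ ζ => h ξ η ζ ω
  exact inner_self_eq_zero.1 (hv v)

theorem eval_eq_zero_iff (π : Rep A) (ρ : Rep B) (x : MinTensor A B) :
    MinTensor.eval π ρ x = 0 ↔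
      ∀ ξ η, ρ.hom (slice (vectorFunctional π ξ η) B x) = 0 := by
  constructor
  · intro h ξ η
    ext ω
    refine ext_inner_left ℂ fun ζ => ?_
    rw [← inner_eval, h, zero_apply, zero_apply, inner_zero_right, inner_zero_right]
  · intro h
    refine operator_eq_zero_of_inner_tmul fun ξ η ζ ω => ?_
    rw [inner_eval, h, zero_apply, inner_zero_right]

/-- Slices along vector functionals separate the points of a minimal tensor product. -/
theorem eq_of_slice_eq {x y : MinTensor A B}
    (h : ∀ (π : Rep A) (ξ η : π.H), slice (vectorFunctional π ξ η) B x =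
      slice (vectorFunctional π ξ η) B y) : x = y := by
  rw [← sub_eq_zero, ← norm_le_zero_iff]
  refine MinTensor.norm_le le_rfl fun π ρ => ?_
  rw [(eval_eq_zero_iff π ρ (x - y)).2 fun ξ η => by rw [map_sub, h, sub_self, map_zero],
    norm_zero]

/-! ### The associativity isomorphism -/

/-- The norm of `A ⊗ (B ⊗ C)` uses all representations of `B ⊗ C` and that of `A ⊗ B ⊗ C` only the
representations `ρ ⊗ τ`; these already separate the points of `B ⊗ C`, in which slices along `A`
take their values. -/
theorem ofRight_injective : Function.Injective (MinTensor₃.ofRight A B C) := by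
  refine (injective_iff_map_eq_zero _).2 fun x hx => ?_
  refine (eq_of_slice_eq (x := x) (y := 0) fun π ξ η => ?_)
  rw [map_zero, ← norm_le_zero_iff]
  refine MinTensor.norm_le le_rfl fun ρ τ => ?_
  let σ : Rep (MinTensor B C) := ⟨HilbertTensor ρ.H τ.H, MinTensor.eval ρ τ⟩
  have h : MinTensor₃.eval π ρ τ (MinTensor₃.ofRight A B C x) = MinTensor.eval π σ x := by
    refine MinTensor.denseRange_ofAlg.induction_on
      (p := fun x => MinTensor₃.eval π ρ τ (MinTensor₃.ofRight A B C x) = MinTensor.eval π σ x) x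
      (isClosed_eq ((continuous_starAlgHom _).comp (continuous_starAlgHom _))
        (continuous_starAlgHom _)) fun x => ?_
    rw [MinTensor.eval_ofAlg]
    refine Eq.trans ?_ (MinTensor₃.eval_algLift_right π ρ τ x)
    congr 1
    exact RepFamily.lift_ofAlg _ _ _ x
  rw [hx, map_zero] at h
  rw [show MinTensor.eval ρ τ (slice (vectorFunctional π ξ η) (MinTensor B C) x) = 0 from
    (eval_eq_zero_iff π σ x).1 h.symm ξ η, norm_zero]

theorem ofRight_surjective : Function.Surjective (MinTensor₃.ofRight A B C) := by
  have h : Set.range (MinTensor₃.ofAlg A B C) ⊆ Set.range (MinTensor₃.ofRight A B C) := by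
    rintro _ ⟨x, rfl⟩
    induction x using TensorProduct.induction_on with
    | zero => exact ⟨0, by simp⟩
    | add x y hx hy =>
      obtain ⟨x', hx⟩ := hx
      obtain ⟨y', hy⟩ := hy
      exact ⟨x' + y', by rw [map_add, map_add, hx, hy]⟩
    | tmul a y => exact ⟨_, MinTensor₃.ofRight_tmul a y⟩
  intro x
  have := (isClosed_range_starAlgHom (MinTensor₃.ofRight A B C)).closure_subset_iff.2 h
  exact this (MinTensor₃.denseRange_ofAlg x)

end Slices

/-! ### Minimal tensor products with a finite-dimensional factor -/

section FiniteDimensional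

set_option linter.unusedSectionVars false

variable {M : Type u} [CStarAlgebra M] [FiniteDimensional ℂ M]
  {B : Type u} [CStarAlgebra B]

variable (M) in
/-- Vector functionals span the dual of `M`, because representations separate the points of `M`. -/
theorem span_vectorFunctional_eq_top :
    Submodule.span ℂ {φ : Module.Dual ℂ M | ∃ (π : Rep M) (ξ η : π.H),
      φ = vectorFunctional π ξ η} = ⊤ := by
  set W := Submodule.span ℂ {φ : Module.Dual ℂ M | ∃ (π : Rep M) (ξ η : π.H),
      φ = vectorFunctional π ξ η}
  have h : W.dualCoannihilator = ⊥ := by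
    refine (Submodule.eq_bot_iff _).2 fun m hm => eq_zero_of_forall_rep fun π => ?_
    ext η
    refine ext_inner_left ℂ fun ξ => ?_
    rw [← vectorFunctional_apply, zero_apply, inner_zero_right]
    exact (Submodule.mem_dualCoannihilator _).1 hm _ (Submodule.subset_span ⟨π, ξ, η, rfl⟩)
  rw [← Subspace.dualCoannihilator_dualAnnihilator_eq (W := W), h,
    Submodule.dualAnnihilator_bot]

/-- Every functional on a finite-dimensional C*-algebra is sliceable, as a linear combination of
vector functionals. -/
theorem isSliceable (φ : M →ₗ[ℂ] ℂ) : IsSliceable φ := by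
  have h : φ ∈ Submodule.span ℂ {φ : Module.Dual ℂ M | ∃ (π : Rep M) (ξ η : π.H),
      φ = vectorFunctional π ξ η} := by
    rw [span_vectorFunctional_eq_top]; exact Submodule.mem_top
  induction h using Submodule.span_induction with
  | mem φ hφ =>
    obtain ⟨π, ξ, η, rfl⟩ := hφ
    exact isSliceable_vectorFunctional π ξ η
  | zero => exact ⟨0, fun B _ x => by simp [algSlice]⟩
  | add φ ψ _ _ h1 h2 =>
    obtain ⟨c, hc⟩ := h1
    obtain ⟨d, hd⟩ := h2
    refine ⟨c + d, fun B _ x => ?_⟩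
    have h : algSlice (φ + ψ) B x = algSlice φ B x + algSlice ψ B x := by
      simp [algSlice, LinearMap.rTensor_add]
    rw [h, add_mul]
    exact (norm_add_le _ _).trans (add_le_add (hc B x) (hd B x))
  | smul a φ _ h1 =>
    obtain ⟨c, hc⟩ := h1
    refine ⟨‖a‖ * c, fun B _ x => ?_⟩
    have h : algSlice (a • φ) B x = a • algSlice φ B x := by
      simp [algSlice, LinearMap.rTensor_smul]
    rw [h, norm_smul, mul_assoc]
    exact mul_le_mul_of_nonneg_left (hc B x) (norm_nonneg a)

variable {ι : Type*} [Fintype ι] (b : Module.Basis ι ℂ M)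

/-- Every element of the completed tensor product `M ⊗ B` is the algebraic tensor given by its
coordinates with respect to a basis of `M`. -/
theorem sum_tmul_slice_coord (x : MinTensor M B) :
    ∑ i, MinTensor.ofAlg M B (b i ⊗ₜ[ℂ] slice (b.coord i) B x) = x := by
  have h : ∀ m : M, Continuous fun y : B => MinTensor.ofAlg M B (m ⊗ₜ[ℂ] y) := fun m => by
    have : (fun y : B => MinTensor.ofAlg M B (m ⊗ₜ[ℂ] y)) =
        fun y => MinTensor.inl M B m * MinTensor.inr M B y := by
      ext y
      change _ = MinTensor.ofAlg M B (m ⊗ₜ[ℂ] 1) * MinTensor.ofAlg M B (1 ⊗ₜ[ℂ] y)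
      rw [← map_mul]; simp
    rw [this]
    exact continuous_const.mul (continuous_starAlgHom _)
  refine MinTensor.denseRange_ofAlg.induction_on
    (p := fun x => ∑ i, MinTensor.ofAlg M B (b i ⊗ₜ[ℂ] slice (b.coord i) B x) = x) x
    (isClosed_eq (continuous_finsetSum _ fun i _ => (h (b i)).comp (slice _ B).continuous)
      continuous_id) fun x => ?_
  induction x using TensorProduct.induction_on with
  | zero => simp
  | add x y hx hy => simp only [map_add, TensorProduct.tmul_add, Finset.sum_add_distrib, hx, hy]
  | tmul m y =>
    simp only [(isSliceable (b.coord _)).slice_tmul, Module.Basis.coord_apply]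
    conv_rhs => rw [← b.sum_repr m, TensorProduct.sum_tmul, map_sum]
    simp only [TensorProduct.tmul_smul, TensorProduct.smul_tmul]

theorem ext_coord {x y : MinTensor M B}
    (h : ∀ i, slice (b.coord i) B x = slice (b.coord i) B y) : x = y := by
  rw [← sum_tmul_slice_coord b x, ← sum_tmul_slice_coord b y]
  simp only [h]

theorem slice_coord_sum (y : ι → B) (i : ι) :
    slice (b.coord i) B (∑ k, MinTensor.ofAlg M B (b k ⊗ₜ[ℂ] y k)) = y i := by
  classical
  simp only [map_sum, (isSliceable (b.coord _)).slice_tmul, Module.Basis.coord_apply,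
    Module.Basis.repr_self, Finsupp.single_apply, ite_smul, one_smul, zero_smul]
  simp

end FiniteDimensional

/-! ### Matrix coefficients of quantum families -/

section Coefficients

set_option linter.unusedSectionVars false

variable {M D D₁ D₂ P : Type u} [CStarAlgebra M] [FiniteDimensional ℂ M] [CStarAlgebra D]
  [CStarAlgebra D₁] [CStarAlgebra D₂] [CStarAlgebra P]
  {ι : Type*} [Fintype ι] (b : Module.Basis ι ℂ M)

/-- The matrix coefficients of a quantum family of maps of a finite quantum space, with respect to
a basis: `Ψ(b_j) = ∑_i b_i ⊗ u_ij`. -/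
def coeff (Ψ : QuantumFamily M M D) (i j : ι) : D := slice (b.coord i) D (Ψ (b j))

/-- The matrix product `∑_k u_ik ⊗ v_kj` of two matrices with entries in C*-algebras. -/
def tensorMul (u : ι → ι → D₁) (v : ι → ι → D₂) (i j : ι) : MinTensor D₁ D₂ :=
  ∑ k, MinTensor.ofAlg D₁ D₂ (u i k ⊗ₜ[ℂ] v k j)

theorem map_tensorMul {D₁' D₂' : Type u} [CStarAlgebra D₁'] [CStarAlgebra D₂']
    (f : D₁ →⋆ₐ[ℂ] D₁') (g : D₂ →⋆ₐ[ℂ] D₂') (u : ι → ι → D₁) (v : ι → ι → D₂) (i j : ι) :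
    MinTensor.map f g (tensorMul u v i j) =
      tensorMul (fun i j => f (u i j)) (fun i j => g (v i j)) i j := by
  simp only [tensorMul, map_sum, MinTensor.map_tmul]

theorem starAlgHom_ext_basis {f g : M →⋆ₐ[ℂ] P} (h : ∀ j, f (b j) = g (b j)) : f = g := by
  have : f.toAlgHom.toLinearMap = g.toAlgHom.toLinearMap := b.ext h
  ext x
  exact LinearMap.congr_fun this x

theorem sum_tmul_coeff (Ψ : QuantumFamily M M D) (j : ι) :
    ∑ i, MinTensor.ofAlg M D (b i ⊗ₜ[ℂ] coeff b Ψ i j) = Ψ (b j) :=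
  sum_tmul_slice_coord b _

theorem quantumFamily_ext_coeff {Ψ Θ : QuantumFamily M M D}
    (h : ∀ i j, coeff b Ψ i j = coeff b Θ i j) : Ψ = Θ :=
  starAlgHom_ext_basis b fun j => ext_coord b fun i => h i j

theorem coeff_reparametrize (Φ : QuantumFamily M M D) (Λ : D →⋆ₐ[ℂ] P) (i j : ι) :
    coeff b (reparametrize Φ Λ) i j = Λ (coeff b Φ i j) :=
  (isSliceable (b.coord i)).slice_map Λ _

theorem reparametrize_eq_iff {Φ : QuantumFamily M M D} {Λ : D →⋆ₐ[ℂ] P}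
    {Θ : QuantumFamily M M P} :
    reparametrize Φ Λ = Θ ↔ ∀ i j, Λ (coeff b Φ i j) = coeff b Θ i j := by
  constructor
  · rintro rfl i j
    exact (coeff_reparametrize b Φ Λ i j).symm
  · exact fun h => quantumFamily_ext_coeff b fun i j => by rw [coeff_reparametrize, h]

theorem composition_basis (Ψ₁ : QuantumFamily M M D₁) (Ψ₂ : QuantumFamily M M D₂) (j : ι) :
    composition Ψ₁ Ψ₂ (b j) = MinTensor₃.ofRight M D₁ D₂
      (∑ i, MinTensor.ofAlg M (MinTensor D₁ D₂)
        (b i ⊗ₜ[ℂ] tensorMul (coeff b Ψ₁) (coeff b Ψ₂) i j)) := by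
  change MinTensor₃.ofLeft M D₁ D₂ (MinTensor.map Ψ₁ (StarAlgHom.id ℂ D₂) (Ψ₂ (b j))) = _
  rw [← sum_tmul_coeff b Ψ₂ j]
  simp only [map_sum, MinTensor.map_tmul, tensorMul, TensorProduct.tmul_sum,
    MinTensor₃.ofRight_tmul, ← sum_tmul_coeff b Ψ₁, TensorProduct.sum_tmul,
    MinTensor₃.ofLeft_tmul, StarAlgHom.coe_id, id]
  exact Finset.sum_comm

/-- Composition of quantum families is the matrix product of their coefficients. -/
theorem composition_eq_iff {Ψ₁ : QuantumFamily M M D₁} {Ψ₂ : QuantumFamily M M D₂}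
    {Θ : QuantumFamily M M (MinTensor D₁ D₂)} :
    composition Ψ₁ Ψ₂ = (MinTensor₃.ofRight M D₁ D₂).comp Θ ↔
      ∀ i j, coeff b Θ i j = tensorMul (coeff b Ψ₁) (coeff b Ψ₂) i j := by
  constructor
  · intro h i j
    have h1 := DFunLike.congr_fun h (b j)
    rw [composition_basis] at h1
    have h2 := ofRight_injective (h1.trans (StarAlgHom.comp_apply _ _ _))
    rw [coeff, ← h2, slice_coord_sum]
  · refine fun h => starAlgHom_ext_basis b fun j => ?_
    rw [composition_basis, StarAlgHom.comp_apply, ← sum_tmul_coeff b Θ]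
    simp only [h]

/-- The composition of two quantum families as a quantum family parametrized by `D₁ ⊗ D₂`. -/
theorem exists_composition (Ψ₁ : QuantumFamily M M D₁) (Ψ₂ : QuantumFamily M M D₂) :
    ∃ Θ : QuantumFamily M M (MinTensor D₁ D₂),
      ∀ i j, coeff b Θ i j = tensorMul (coeff b Ψ₁) (coeff b Ψ₂) i j := by
  let e := StarAlgEquiv.ofBijective (MinTensor₃.ofRight M D₁ D₂)
    ⟨ofRight_injective, ofRight_surjective⟩
  refine ⟨(e.symm : MinTensor₃ M D₁ D₂ →⋆ₐ[ℂ] _).comp (composition Ψ₁ Ψ₂),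
    (composition_eq_iff b).1 ?_⟩
  ext x
  exact (e.apply_symm_apply (composition Ψ₁ Ψ₂ x)).symm

theorem isCompositionComul_iff {Φ : QuantumFamily M M D} {Δ : D →⋆ₐ[ℂ] MinTensor D D} :
    IsCompositionComul Φ Δ ↔
      ∀ i j, Δ (coeff b Φ i j) = tensorMul (coeff b Φ) (coeff b Φ) i j := by
  simp only [IsCompositionComul, composition_eq_iff b, coeff_reparametrize]

theorem flip₂₃_ofRight_tmul (m : M) (y : D₁ ⊗[ℂ] D₂) :
    MinTensor₃.flip₂₃ M D₁ D₂ (MinTensor₃.ofRight M D₁ D₂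
        (MinTensor.ofAlg _ _ (m ⊗ₜ[ℂ] MinTensor.ofAlg D₁ D₂ y))) =
      MinTensor₃.ofRight M D₂ D₁
        (MinTensor.ofAlg _ _ (m ⊗ₜ[ℂ] MinTensor.ofAlg D₂ D₁ (algFlip D₁ D₂ y))) := by
  rw [MinTensor₃.ofRight_tmul, MinTensor₃.ofRight_tmul, ← algFlip₂₃_tmul]
  exact RepFamily.lift_ofAlg _ _ _ _

/-- Commutation in coefficients. The flip is applied to `Θ △ Ψ`, so both sides are written in
`D ⊗ P`. -/
theorem commuting_iff {Θ : QuantumFamily M M P} {Ψ : QuantumFamily M M D} :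
    Commuting Θ Ψ ↔ ∀ i j,
      ∑ k, MinTensor.ofAlg D P (coeff b Ψ k j ⊗ₜ[ℂ] coeff b Θ i k) =
        ∑ k, MinTensor.ofAlg D P (coeff b Ψ i k ⊗ₜ[ℂ] coeff b Θ k j) := by
  have h1 : ∀ j, MinTensor₃.flip₂₃ M P D (composition Θ Ψ (b j)) = MinTensor₃.ofRight M D P
      (∑ i, MinTensor.ofAlg M (MinTensor D P)
        (b i ⊗ₜ[ℂ] ∑ k, MinTensor.ofAlg D P (coeff b Ψ k j ⊗ₜ[ℂ] coeff b Θ i k))) := fun j => by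
    rw [composition_basis]
    simp only [tensorMul, ← map_sum (MinTensor.ofAlg P D)]
    rw [map_sum, map_sum]
    simp only [flip₂₃_ofRight_tmul]
    simp only [map_sum, algFlip_tmul]
  constructor
  · intro h i j
    have h2 := (h1 j).symm.trans (DFunLike.congr_fun h (b j))
    rw [composition_basis] at h2
    have h3 := congrArg (slice (b.coord i) (MinTensor D P)) (ofRight_injective h2)
    rwa [slice_coord_sum, slice_coord_sum] at h3
  · refine fun h => starAlgHom_ext_basis b fun j => ?_
    rw [composition_basis, StarAlgHom.comp_apply, h1]
    simp only [h, tensorMul]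

/-- Commutation with `Ψ` is a family of linear relations between the coefficients, one for every
vector functional on `D`: the matrix of coefficients commutes with the scalar matrices
`φ(d_ij)`. -/
theorem commuting_iff_slice {Θ : QuantumFamily M M P} {Ψ : QuantumFamily M M D} :
    Commuting Θ Ψ ↔ ∀ (π : Rep D) (ξ η : π.H) (i j : ι),
      ∑ k, vectorFunctional π ξ η (coeff b Ψ k j) • coeff b Θ i k =
        ∑ k, vectorFunctional π ξ η (coeff b Ψ i k) • coeff b Θ k j := by
  rw [commuting_iff b]
  constructor
  · intro h π ξ η i j
    have := congrArg (slice (vectorFunctional π ξ η) P) (h i j)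
    simpa only [map_sum, (isSliceable_vectorFunctional π ξ η).slice_tmul] using this
  · refine fun h i j => eq_of_slice_eq fun π ξ η => ?_
    simpa only [map_sum, (isSliceable_vectorFunctional π ξ η).slice_tmul] using h π ξ η i j

theorem Commuting.reparametrize {Θ : QuantumFamily M M P} {Ψ : QuantumFamily M M D}
    (h : Commuting Θ Ψ) (Λ : P →⋆ₐ[ℂ] D₁) :
    Commuting (QuantumFamilies.reparametrize Θ Λ) Ψ := by
  classical
  let b := Module.Free.chooseBasis ℂ M
  rw [commuting_iff_slice b] at h ⊢
  intro π ξ η i j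
  simpa only [coeff_reparametrize, map_sum, map_smul] using congrArg Λ (h π ξ η i j)

/-- If two quantum families commute with `Ψ`, so does their composition: their coefficient matrices
commute with the scalar matrices `φ(d_ij)`, hence so does the product of these matrices. -/
theorem commuting_of_coeff_eq_tensorMul {Θ₁ : QuantumFamily M M D₁} {Θ₂ : QuantumFamily M M D₂}
    {Ψ : QuantumFamily M M D} (h₁ : Commuting Θ₁ Ψ) (h₂ : Commuting Θ₂ Ψ)
    {Θ : QuantumFamily M M (MinTensor D₁ D₂)}
    (h : ∀ i j, coeff b Θ i j = tensorMul (coeff b Θ₁) (coeff b Θ₂) i j) : Commuting Θ Ψ := by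
  rw [commuting_iff_slice b] at h₁ h₂ ⊢
  intro π ξ η i j
  set φ := vectorFunctional π ξ η
  calc ∑ k, φ (coeff b Ψ k j) • coeff b Θ i k
      = ∑ l, MinTensor.ofAlg D₁ D₂
          (coeff b Θ₁ i l ⊗ₜ[ℂ] ∑ k, φ (coeff b Ψ k j) • coeff b Θ₂ l k) := by
        simp only [h, tensorMul, Finset.smul_sum, TensorProduct.tmul_sum, map_sum,
          TensorProduct.tmul_smul, map_smul]
        exact Finset.sum_comm
    _ = ∑ l, MinTensor.ofAlg D₁ D₂
          (coeff b Θ₁ i l ⊗ₜ[ℂ] ∑ k, φ (coeff b Ψ l k) • coeff b Θ₂ k j) := by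
        simp only [φ, h₂ π ξ η]
    _ = ∑ k, MinTensor.ofAlg D₁ D₂
          ((∑ l, φ (coeff b Ψ l k) • coeff b Θ₁ i l) ⊗ₜ[ℂ] coeff b Θ₂ k j) := by
        simp only [TensorProduct.tmul_sum, TensorProduct.sum_tmul, map_sum,
          TensorProduct.tmul_smul, ← TensorProduct.smul_tmul', map_smul]
        exact Finset.sum_comm
    _ = ∑ k, MinTensor.ofAlg D₁ D₂
          ((∑ l, φ (coeff b Ψ i l) • coeff b Θ₁ l k) ⊗ₜ[ℂ] coeff b Θ₂ k j) := by
        simp only [φ, h₁ π ξ η]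
    _ = ∑ k, φ (coeff b Ψ i k) • coeff b Θ k j := by
        simp only [h, tensorMul, Finset.smul_sum, TensorProduct.sum_tmul, map_sum,
          ← TensorProduct.smul_tmul', map_smul]
        exact Finset.sum_comm

theorem coeff_inl [DecidableEq ι] (i j : ι) :
    coeff b (MinTensor.inl M P) i j = if i = j then 1 else 0 := by
  change slice (b.coord i) P (MinTensor.ofAlg M P (b j ⊗ₜ[ℂ] 1)) = _
  rw [(isSliceable _).slice_tmul, Module.Basis.coord_apply, Module.Basis.repr_self,
    Finsupp.single_apply]
  simp [eq_comm]

/-- The constant family of identity maps `m ↦ m ⊗ 1` commutes with every quantum family. -/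
theorem commuting_inl (Ψ : QuantumFamily M M D) : Commuting (MinTensor.inl M P) Ψ := by
  classical
  let b := Module.Free.chooseBasis ℂ M
  rw [commuting_iff_slice b]
  intro π ξ η i j
  simp [coeff_inl]

end Coefficients

/-! ### Free `*`-algebras -/

section FreeStarAlgebra

instance (X : Type*) : StarModule ℝ (FreeAlgebra ℝ X) where
  star_smul r x := by
    rw [Algebra.smul_def, star_mul, FreeAlgebra.star_algebraMap, star_trivial r,
      Algebra.smul_def, Algebra.commutes]

/-- The free unital complex `*`-algebra on the set `X`: the complexification of the real free
algebra on self-adjoint generators, two for each element of `X` (a real and an imaginary part).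
The complexification makes the involution conjugate-linear, while the involution of Mathlib on a
free algebra over `ℂ` is linear. -/
abbrev FreeStarAlgebra (X : Type u) : Type u := ℂ ⊗[ℝ] FreeAlgebra ℝ (X × Bool)

instance (X : Type u) : StarModule ℂ (FreeStarAlgebra X) where
  star_smul c x := by
    induction x using TensorProduct.induction_on with
    | zero => simp
    | add x y hx hy => simp only [smul_add, star_add, hx, hy]
    | tmul z y =>
      rw [TensorProduct.smul_tmul', TensorProduct.star_tmul, TensorProduct.star_tmul,
        TensorProduct.smul_tmul', star_smul]

namespace FreeStarAlgebra

variable {X : Type u} {P : Type u} [CStarAlgebra P]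

/-- The self-adjoint generators: the real parts (`false`) and the imaginary parts (`true`) of the
generators. -/
def saGen (p : X × Bool) : FreeStarAlgebra X := 1 ⊗ₜ[ℝ] FreeAlgebra.ι ℝ p

/-- The generators of the free `*`-algebra, which satisfy no relation with their adjoints. -/
def gen (x : X) : FreeStarAlgebra X := saGen (x, false) + Complex.I • saGen (x, true)

theorem star_saGen (p : X × Bool) : star (saGen p) = saGen p := by
  rw [saGen, TensorProduct.star_tmul, star_one, FreeAlgebra.star_ι]

theorem star_gen (x : X) : star (gen x) = saGen (x, false) - Complex.I • saGen (x, true) := by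
  rw [gen, star_add, star_smul, star_saGen, star_saGen, Complex.star_def, Complex.conj_I, neg_smul,
    sub_eq_add_neg]

/-- The free `*`-algebra is generated by `gen`, as `saGen` consists of the real and imaginary parts
of these elements. -/
theorem eq_top_of_forall_gen_mem {T : StarSubalgebra ℂ (FreeStarAlgebra X)}
    (h : ∀ x, gen x ∈ T) : T = ⊤ := by
  have hsa : ∀ p : X × Bool, saGen p ∈ T := by
    rintro ⟨x, _ | _⟩
    · have h1 : saGen (x, false) = (1 / 2 : ℂ) • (gen x + star (gen x)) := by
        rw [star_gen, gen]; module
      rw [h1]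
      exact T.smul_mem (add_mem (h x) (star_mem (h x))) _
    · have h1 : saGen (x, true) = (-Complex.I / 2 : ℂ) • (gen x - star (gen x)) := by
        rw [star_gen, gen]
        match_scalars
        · linear_combination Complex.I_mul_I
        · ring
      rw [h1]
      exact T.smul_mem (sub_mem (h x) (star_mem (h x))) _
  have h2 : ∀ y : FreeAlgebra ℝ (X × Bool), (1 : ℂ) ⊗ₜ[ℝ] y ∈ T := fun y => by
    induction y using FreeAlgebra.induction with
    | grade0 r =>
      have : (1 : ℂ) ⊗ₜ[ℝ] algebraMap ℝ (FreeAlgebra ℝ (X × Bool)) r =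
          (r : ℂ) • (1 : FreeStarAlgebra X) := by
        rw [Algebra.algebraMap_eq_smul_one, Algebra.TensorProduct.one_def,
          TensorProduct.smul_tmul', ← TensorProduct.smul_tmul]
        simp
      rw [this]
      exact T.smul_mem (one_mem T) _
    | grade1 p => exact hsa p
    | mul a b ha hb =>
      have : (1 : ℂ) ⊗ₜ[ℝ] (a * b) = ((1 : ℂ) ⊗ₜ[ℝ] a) * (1 ⊗ₜ[ℝ] b) := by simp
      rw [this]
      exact mul_mem ha hb
    | add a b ha hb => rw [TensorProduct.tmul_add]; exact add_mem ha hb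
  refine eq_top_iff.2 fun z _ => ?_
  induction z using TensorProduct.induction_on with
  | zero => exact zero_mem T
  | add x y hx hy => exact add_mem (hx trivial) (hy trivial)
  | tmul c y =>
    have : c ⊗ₜ[ℝ] y = c • ((1 : ℂ) ⊗ₜ[ℝ] y) := by rw [TensorProduct.smul_tmul']; simp
    rw [this]
    exact T.smul_mem (h2 y) _

open scoped ComplexStarModule

/-- The images of the self-adjoint generators under the homomorphism sending the generators to
given elements. -/
def saPart (t : X → P) (p : X × Bool) : P := if p.2 then (ℑ (t p.1) : P) else (ℜ (t p.1) : P)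

theorem star_saPart (t : X → P) (p : X × Bool) : star (saPart t p) = saPart t p := by
  unfold saPart
  split
  · exact (ℑ (t p.1)).2
  · exact (ℜ (t p.1)).2

theorem star_freeAlgebraLift {t : X × Bool → P} (ht : ∀ p, star (t p) = t p)
    (y : FreeAlgebra ℝ (X × Bool)) :
    FreeAlgebra.lift ℝ t (star y) = star (FreeAlgebra.lift ℝ t y) := by
  induction y using FreeAlgebra.induction with
  | grade0 r =>
    rw [FreeAlgebra.star_algebraMap, AlgHom.commutes, Algebra.algebraMap_eq_smul_one, star_smul,
      star_one, star_trivial]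
  | grade1 p => rw [FreeAlgebra.star_ι, FreeAlgebra.lift_ι_apply, ht]
  | mul a b ha hb => rw [star_mul, map_mul, map_mul, star_mul, ha, hb]
  | add a b ha hb => rw [star_add, map_add, map_add, star_add, ha, hb]

theorem commute_ofId_lift (t : X → P) (c : ℂ) (y : FreeAlgebra ℝ (X × Bool)) :
    Commute (Algebra.ofId ℂ P c) (FreeAlgebra.lift ℝ (saPart t) y) :=
  Algebra.commute_algebraMap_left c _

/-- The homomorphism out of the free `*`-algebra with given values at the generators, as a
homomorphism of algebras. -/
def liftAlgHom (t : X → P) : FreeStarAlgebra X →ₐ[ℂ] P :=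
  Algebra.TensorProduct.lift (Algebra.ofId ℂ P) (FreeAlgebra.lift ℝ (saPart t))
    (commute_ofId_lift t)

theorem liftAlgHom_tmul (t : X → P) (c : ℂ) (y : FreeAlgebra ℝ (X × Bool)) :
    liftAlgHom t (c ⊗ₜ[ℝ] y) = c • FreeAlgebra.lift ℝ (saPart t) y := by
  rw [liftAlgHom, Algebra.TensorProduct.lift_tmul, Algebra.ofId_apply, Algebra.smul_def]

/-- The `*`-homomorphism out of the free `*`-algebra with given values at the generators. -/
def lift (t : X → P) : FreeStarAlgebra X →⋆ₐ[ℂ] P :=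
  { liftAlgHom t with
    map_star' := fun x => by
      change liftAlgHom t (star x) = star (liftAlgHom t x)
      induction x using TensorProduct.induction_on with
      | zero => simp
      | add x y hx hy => rw [star_add, map_add, map_add, star_add, hx, hy]
      | tmul c y =>
        rw [TensorProduct.star_tmul, liftAlgHom_tmul, liftAlgHom_tmul,
          star_freeAlgebraLift (star_saPart t), star_smul] }

theorem lift_saGen (t : X → P) (p : X × Bool) : lift t (saGen p) = saPart t p :=
  (liftAlgHom_tmul t 1 _).trans (by rw [one_smul, FreeAlgebra.lift_ι_apply])

theorem lift_gen (t : X → P) (x : X) : lift t (gen x) = t x := by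
  rw [gen, map_add, map_smul, lift_saGen, lift_saGen]
  simp [saPart, realPart_add_I_smul_imaginaryPart]

theorem hom_ext {f g : FreeStarAlgebra X →⋆ₐ[ℂ] P} (h : ∀ x, f (gen x) = g (gen x)) : f = g := by
  have : StarAlgHom.equalizer f g = ⊤ := eq_top_of_forall_gen_mem h
  ext x
  exact (StarAlgHom.mem_equalizer f g x).1 (this ▸ StarSubalgebra.mem_top)

/-- A family of representations of a free `*`-algebra is pointwise bounded if it is bounded at the
generators. -/
theorem bdd_of_forall_gen {I : Type*} (π : I → Rep (FreeStarAlgebra X))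
    (h : ∀ x, ∃ C, ∀ i, ‖(π i).hom (gen x)‖ ≤ C) (y : FreeStarAlgebra X) :
    BddAbove (Set.range fun i => ‖(π i).hom y‖) := by
  let T : StarSubalgebra ℂ (FreeStarAlgebra X) :=
    { carrier := {y | ∃ C, ∀ i, ‖(π i).hom y‖ ≤ C}
      mul_mem' := by
        rintro a b ⟨c, hc⟩ ⟨d, hd⟩
        refine ⟨c * d, fun i => ?_⟩
        rw [map_mul]
        exact (norm_mul_le _ _).trans
          (mul_le_mul (hc i) (hd i) (norm_nonneg _) ((norm_nonneg _).trans (hc i)))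
      add_mem' := by
        rintro a b ⟨c, hc⟩ ⟨d, hd⟩
        refine ⟨c + d, fun i => ?_⟩
        rw [map_add]
        exact (norm_add_le _ _).trans (add_le_add (hc i) (hd i))
      algebraMap_mem' := fun z => by
        refine ⟨‖z‖, fun i => ?_⟩
        rw [AlgHomClass.commutes, Algebra.algebraMap_eq_smul_one, norm_smul]
        exact mul_le_of_le_one_right (norm_nonneg z) ContinuousLinearMap.norm_id_le
      star_mem' := by
        rintro a ⟨c, hc⟩
        refine ⟨c, fun i => ?_⟩
        rw [map_star, norm_star]
        exact hc i }
  have hT : T = ⊤ := eq_top_of_forall_gen_mem h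
  obtain ⟨C, hC⟩ : y ∈ T := hT ▸ StarSubalgebra.mem_top
  exact ⟨C, by rintro _ ⟨i, rfl⟩; exact hC i⟩

end FreeStarAlgebra

end FreeStarAlgebra

/-! ### The universal quantum family of commuting maps -/

section Universal

variable {M D : Type u} [CStarAlgebra M] [FiniteDimensional ℂ M] [CStarAlgebra D]
  {ι : Type u} [Fintype ι] (b : Module.Basis ι ℂ M) (Ψ : QuantumFamily M M D)

set_option linter.unusedSectionVars false

open FreeStarAlgebra

/-- A matrix `u_ij` over `U` consists of the coefficients of a quantum family if its images under a
separating family of `*`-homomorphisms do. -/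
theorem exists_quantumFamily_of_separating {U : Type u} [CStarAlgebra U] {I : Type*}
    {B : I → Type u} [∀ k, CStarAlgebra (B k)] {σ : ∀ k, U →⋆ₐ[ℂ] B k}
    (hσ : ∀ x y, (∀ k, σ k x = σ k y) → x = y) {u : ι → ι → U}
    {Θ : ∀ k, QuantumFamily M M (B k)} (hΘ : ∀ k i j, coeff b (Θ k) i j = σ k (u i j)) :
    ∃ Φ : QuantumFamily M M U, ∀ i j, coeff b Φ i j = u i j := by
  let L : M →ₗ[ℂ] MinTensor M U := b.constr ℂ fun j => ∑ i, MinTensor.ofAlg M U (b i ⊗ₜ[ℂ] u i j)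
  have hLb : ∀ j, L (b j) = ∑ i, MinTensor.ofAlg M U (b i ⊗ₜ[ℂ] u i j) := fun j =>
    Module.Basis.constr_basis _ _ _ _
  have hL : ∀ k m, MinTensor.map (StarAlgHom.id ℂ M) (σ k) (L m) = Θ k m := fun k m => by
    have h : (MinTensor.map (StarAlgHom.id ℂ M) (σ k)).toAlgHom.toLinearMap ∘ₗ L =
        (Θ k).toAlgHom.toLinearMap := by
      refine b.ext fun j => ?_
      change MinTensor.map (StarAlgHom.id ℂ M) (σ k) (L (b j)) = Θ k (b j)
      simp only [hLb, map_sum, MinTensor.map_tmul, ← sum_tmul_coeff b (Θ k), hΘ, StarAlgHom.coe_id,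
        id]
    exact LinearMap.congr_fun h m
  have hinj : ∀ x y : MinTensor M U, (∀ k, MinTensor.map (StarAlgHom.id ℂ M) (σ k) x =
      MinTensor.map (StarAlgHom.id ℂ M) (σ k) y) → x = y := fun x y h =>
    ext_coord b fun i => hσ _ _ fun k => by
      rw [← (isSliceable _).slice_map, ← (isSliceable _).slice_map, h]
  refine ⟨{
    toFun := L
    map_one' := hinj _ _ fun k => by rw [hL, map_one, map_one]
    map_mul' := fun x y => hinj _ _ fun k => by
      rw [hL, map_mul (Θ k), map_mul (MinTensor.map _ _), hL, hL]
    map_zero' := map_zero L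
    map_add' := map_add L
    commutes' := fun c => hinj _ _ fun k => by
      rw [hL, AlgHomClass.commutes, AlgHomClass.commutes]
    map_star' := fun x => hinj _ _ fun k => by
      rw [hL, map_star (Θ k), map_star (MinTensor.map _ _), hL] }, fun i j => ?_⟩
  change slice (b.coord i) U (L (b j)) = _
  rw [hLb, slice_coord_sum]

/-- Commutation with `Ψ` consists of linear relations between coefficients, so it can be tested with
a separating family of `*`-homomorphisms. -/
theorem commuting_of_separating {U : Type u} [CStarAlgebra U] {I : Type*}
    {B : I → Type u} [∀ k, CStarAlgebra (B k)] {σ : ∀ k, U →⋆ₐ[ℂ] B k}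
    (hσ : ∀ x y, (∀ k, σ k x = σ k y) → x = y) {Φ : QuantumFamily M M U}
    (h : ∀ k, Commuting (reparametrize Φ (σ k)) Ψ) : Commuting Φ Ψ := by
  let b := Module.Free.chooseBasis ℂ M
  rw [commuting_iff_slice b]
  refine fun π ξ η i j => hσ _ _ fun k => ?_
  have := (commuting_iff_slice b).1 (h k) π ξ η i j
  simpa only [map_sum, map_smul, coeff_reparametrize] using this

/-- The representations of the free `*`-algebra on the matrix entries `u_ij` for which
`b_j ↦ ∑_i b_i ⊗ u_ij` is a quantum family of maps commuting with `Ψ`. -/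
def IsCommutingRep (π : Rep (FreeStarAlgebra (ι × ι))) : Prop :=
  ∃ Θ : QuantumFamily M M (π.H →L[ℂ] π.H), Commuting Θ Ψ ∧
    ∀ i j, coeff b Θ i j = π.hom (gen (i, j))

/-- Coefficients of quantum families are bounded uniformly in the parameter algebra. -/
theorem exists_norm_coeff_le (i j : ι) : ∃ C, ∀ (P : Type u) [CStarAlgebra P]
    (Θ : QuantumFamily M M P), ‖coeff b Θ i j‖ ≤ C := by
  obtain ⟨C, hC⟩ := (isSliceable (b.coord i)).exists_norm_slice_le
  refine ⟨|C| * ‖b j‖, fun P _ Θ => (hC _ _).trans ?_⟩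
  exact mul_le_mul (le_abs_self C) (NonUnitalStarAlgHom.norm_apply_le Θ _) (norm_nonneg _)
    (abs_nonneg C)

/-- The defining representations are bounded at each `u_ij`, since quantum families are contractive
and slice maps are bounded, uniformly in the second factor. -/
theorem bdd_of_isCommutingRep {I : Type*} (π : I → Rep (FreeStarAlgebra (ι × ι)))
    (h : ∀ k, IsCommutingRep b Ψ (π k)) (y : FreeStarAlgebra (ι × ι)) :
    BddAbove (Set.range fun k => ‖(π k).hom y‖) := by
  refine bdd_of_forall_gen π (fun p => ?_) y
  obtain ⟨C, hC⟩ := exists_norm_coeff_le b p.1 p.2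
  refine ⟨C, fun k => ?_⟩
  obtain ⟨Θ, -, hΘ⟩ := h k
  exact (congrArg norm (hΘ p.1 p.2)).symm.trans_le (hC _ Θ)

/-- The family of all representations satisfying a predicate. -/
def RepFamily.ofPred {R : Type u} [Ring R] [StarRing R] [Algebra ℂ R]
    (p : Rep R → Prop)
    (hp : ∀ x, BddAbove (Set.range fun π : {π // p π} => ‖π.1.hom x‖)) : RepFamily R where
  index := {π // p π}
  rep π := π.1
  bdd := hp

/-- The universal property of the C*-completion of a free `*`-algebra with respect to the family of
all representations that come from commuting quantum families. The homomorphism on the free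
`*`-algebra given by the coefficients of a commuting family `Θ` is bounded, because its composition
with a representation of `P` belongs to the defining family, and the norm of `P` is recovered by
representations. -/
theorem isUniversalCommuting_of_coeff {F : RepFamily (FreeStarAlgebra (ι × ι))}
    (hF : ∀ π, IsCommutingRep b Ψ π → ∀ x, ‖π.hom x‖ ≤ F.seminorm x)
    {Φ : QuantumFamily M M F.CStarCompletion}
    (hΦ : ∀ i j, coeff b Φ i j = F.ofAlg (gen (i, j))) : IsUniversalCommuting Ψ Φ := by
  intro P _ Θ hΘ
  let f : FreeStarAlgebra (ι × ι) →⋆ₐ[ℂ] P := FreeStarAlgebra.lift fun p => coeff b Θ p.1 p.2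
  have hfg : ∀ i j, f (gen (i, j)) = coeff b Θ i j := fun i j => lift_gen _ _
  have hf : ∀ x, ‖f x‖ ≤ F.seminorm x := fun x =>
    norm_le_of_forall_rep (RepFamily.seminorm_nonneg _ x) fun ρ => by
      refine hF ⟨ρ.H, ρ.hom.comp f⟩ ?_ x
      refine ⟨reparametrize Θ ρ.hom, hΘ.reparametrize ρ.hom, fun i j => ?_⟩
      rw [coeff_reparametrize, StarAlgHom.comp_apply, hfg]
  refine ⟨F.lift f hf, ?_, fun Λ hΛ => ?_⟩
  · refine (reparametrize_eq_iff b).2 fun i j => ?_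
    rw [hΦ, RepFamily.lift_ofAlg, hfg]
  · have hΛ' := (reparametrize_eq_iff b).1 hΛ
    refine F.hom_ext fun x => ?_
    rw [RepFamily.lift_ofAlg]
    have : Λ.comp F.ofAlg = f := FreeStarAlgebra.hom_ext fun p => by
      rw [StarAlgHom.comp_apply, hfg p.1 p.2, ← hΦ, hΛ']
    exact DFunLike.congr_fun this x

theorem eq_top_of_forall_ofAlg_gen_mem {X : Type u} {F : RepFamily (FreeStarAlgebra X)}
    {S : StarSubalgebra ℂ F.CStarCompletion} (hS : IsClosed (S : Set F.CStarCompletion))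
    (h : ∀ x, F.ofAlg (gen x) ∈ S) : S = ⊤ := by
  have h1 : S.comap F.ofAlg = ⊤ := eq_top_of_forall_gen_mem h
  refine eq_top_iff.2 fun x _ => ?_
  refine F.denseRange_ofAlg.induction_on (p := fun x => x ∈ S) x hS fun y => ?_
  have : y ∈ S.comap F.ofAlg := h1 ▸ StarSubalgebra.mem_top
  exact this

/-- The completion with respect to a family of representations that contains, up to the norm, all
`IsCommutingRep` representations and no others carries the universal quantum family. -/
theorem exists_universal_of_repFamily {F : RepFamily (FreeStarAlgebra (ι × ι))}
    (hF₁ : ∀ k, IsCommutingRep b Ψ (F.rep k))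
    (hF₂ : ∀ π, IsCommutingRep b Ψ π → ∀ x, ‖π.hom x‖ ≤ F.seminorm x) :
    ∃ Φ : QuantumFamily M M F.CStarCompletion, IsUniversalCommuting Ψ Φ ∧ Commuting Φ Ψ ∧
      ∀ S : StarSubalgebra ℂ F.CStarCompletion, IsClosed (S : Set F.CStarCompletion) →
        (∀ i j, coeff b Φ i j ∈ S) → S = ⊤ := by
  choose Θ hΘ hΘ' using hF₁
  have hσ : ∀ x y, (∀ k, F.extendRep k x = F.extendRep k y) → x = y := fun x y h => by
    rw [← sub_eq_zero, ← norm_le_zero_iff]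
    exact F.norm_le_of_extendRep le_rfl fun k => by rw [map_sub, h, sub_self, norm_zero]
  have hσΘ : ∀ k i j, coeff b (Θ k) i j = F.extendRep k (F.ofAlg (gen (i, j))) := fun k i j =>
    (hΘ' k i j).trans (F.lift_ofAlg _ _ _).symm
  obtain ⟨Φ, hΦ⟩ := exists_quantumFamily_of_separating b hσ (u := fun i j => F.ofAlg (gen (i, j)))
    hσΘ
  refine ⟨Φ, isUniversalCommuting_of_coeff b Ψ hF₂ hΦ, commuting_of_separating Ψ hσ fun k => ?_,
    fun S hS h => eq_top_of_forall_ofAlg_gen_mem hS fun p => ?_⟩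
  · have : reparametrize Φ (F.extendRep k) = Θ k :=
      (reparametrize_eq_iff b).2 fun i j => by rw [hΦ, hσΘ]
    rw [this]
    exact hΘ k
  · rw [← hΦ]
    exact h p.1 p.2

/-- Existence of the universal quantum family of maps commuting with `Ψ`; its coefficients generate
the C*-algebra that parametrizes it. -/
theorem exists_universal :
    ∃ (U : Type u) (_ : CStarAlgebra U) (Φ : QuantumFamily M M U),
      IsUniversalCommuting Ψ Φ ∧ Commuting Φ Ψ ∧
        ∀ S : StarSubalgebra ℂ U, IsClosed (S : Set U) → (∀ i j, coeff b Φ i j ∈ S) → S = ⊤ := by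
  let F := RepFamily.ofPred (IsCommutingRep b Ψ) (bdd_of_isCommutingRep b Ψ _ fun π => π.2)
  exact ⟨F.CStarCompletion, inferInstance, exists_universal_of_repFamily b Ψ (F := F)
    (fun k => k.2) fun π hπ => F.le_seminorm ⟨π, hπ⟩⟩

end Universal

/-! ### Uniqueness and the semigroup structure -/

section Semigroup

variable {M D E P : Type u} [CStarAlgebra M] [FiniteDimensional ℂ M] [CStarAlgebra D]
  [CStarAlgebra E] [CStarAlgebra P] {ι : Type u} [Fintype ι] (b : Module.Basis ι ℂ M)
  {Ψ : QuantumFamily M M D} {Φ : QuantumFamily M M E}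

set_option linter.unusedSectionVars false

theorem IsUniversalCommuting.hom_ext (h : IsUniversalCommuting Ψ Φ) (hc : Commuting Φ Ψ)
    {f g : E →⋆ₐ[ℂ] P} (hfg : reparametrize Φ f = reparametrize Φ g) : f = g :=
  (h P _ (hc.reparametrize g)).unique hfg rfl

theorem IsUniversalCommuting.hom_ext_coeff (h : IsUniversalCommuting Ψ Φ) (hc : Commuting Φ Ψ)
    {f g : E →⋆ₐ[ℂ] P} (hfg : ∀ i j, f (coeff b Φ i j) = g (coeff b Φ i j)) : f = g :=
  h.hom_ext hc ((reparametrize_eq_iff b).2 fun i j => by rw [hfg, coeff_reparametrize])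

theorem IsFamilyOfAllMaps.hom_ext_coeff (h : IsFamilyOfAllMaps Φ) {f g : E →⋆ₐ[ℂ] P}
    (hfg : ∀ i j, f (coeff b Φ i j) = g (coeff b Φ i j)) : f = g :=
  (h P (reparametrize Φ g)).unique
    ((reparametrize_eq_iff b).2 fun i j => by rw [hfg, coeff_reparametrize]) rfl

theorem reparametrize_id (Φ : QuantumFamily M M E) :
    reparametrize Φ (StarAlgHom.id ℂ E) = Φ :=
  (reparametrize_eq_iff (Module.Free.chooseBasis ℂ M)).2 fun _ _ => rfl

theorem reparametrize_comp {E' : Type u} [CStarAlgebra E'] (Φ : QuantumFamily M M E)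
    (f : E →⋆ₐ[ℂ] E') (g : E' →⋆ₐ[ℂ] P) :
    reparametrize Φ (g.comp f) = reparametrize (reparametrize Φ f) g :=
  (reparametrize_eq_iff (Module.Free.chooseBasis ℂ M)).2 fun i j => by
    rw [coeff_reparametrize, coeff_reparametrize]; rfl

/-- Universal quantum families commuting with `Ψ` are isomorphic in a unique way. -/
theorem IsUniversalCommuting.existsUnique_starAlgEquiv {E' : Type u} [CStarAlgebra E']
    {Φ' : QuantumFamily M M E'} (h : IsUniversalCommuting Ψ Φ) (hc : Commuting Φ Ψ)
    (h' : IsUniversalCommuting Ψ Φ') (hc' : Commuting Φ' Ψ) :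
    ∃! e : E ≃⋆ₐ[ℂ] E', reparametrize Φ (e : E →⋆ₐ[ℂ] E') = Φ' := by
  obtain ⟨f, hf, -⟩ := h E' Φ' hc'
  obtain ⟨g, hg, -⟩ := h' E Φ hc
  have hgf : g.comp f = StarAlgHom.id ℂ E := h.hom_ext hc (by
    rw [reparametrize_comp, hf, hg, reparametrize_id])
  have hfg : f.comp g = StarAlgHom.id ℂ E' := h'.hom_ext hc' (by
    rw [reparametrize_comp, hg, hf, reparametrize_id])
  let e : E ≃⋆ₐ[ℂ] E' := StarAlgEquiv.ofStarAlgHom f g hgf hfg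
  have he : (e : E →⋆ₐ[ℂ] E') = f := by ext x; rfl
  refine ⟨e, (congrArg (reparametrize Φ) he).trans hf, fun e' he' => ?_⟩
  have h1 : (e' : E →⋆ₐ[ℂ] E') = f := h.hom_ext hc (he'.trans hf.symm)
  ext x
  exact DFunLike.congr_fun (h1.trans he.symm) x

/-- A comultiplication given by matrix multiplication of the coefficients is coassociative at the
coefficients, because the product of matrices is associative. -/
theorem coassociative_coeff {Δ : E →⋆ₐ[ℂ] MinTensor E E} {u : ι → ι → E}
    (hΔ : ∀ i j, Δ (u i j) = tensorMul u u i j) (i j : ι) :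
    MinTensor₃.ofLeft E E E (MinTensor.map Δ (StarAlgHom.id ℂ E) (Δ (u i j))) =
      MinTensor₃.ofRight E E E (MinTensor.map (StarAlgHom.id ℂ E) Δ (Δ (u i j))) := by
  rw [hΔ, map_tensorMul, map_tensorMul]
  simp only [hΔ, tensorMul, StarAlgHom.coe_id, id, TensorProduct.sum_tmul, TensorProduct.tmul_sum,
    map_sum, MinTensor₃.ofLeft_tmul, MinTensor₃.ofRight_tmul]
  exact Finset.sum_comm

/-- The universal family is a quantum semigroup with unit: the composition of the universal family
with itself commutes with `Ψ` and gives the comultiplication, the family of identity maps gives the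
counit. -/
theorem IsUniversalCommuting.exists_comul (h : IsUniversalCommuting Ψ Φ) (hc : Commuting Φ Ψ) :
    ∃ Δ : E →⋆ₐ[ℂ] MinTensor E E, IsQuantumSemigroupWithUnit Δ ∧
      ∀ i j, Δ (coeff b Φ i j) = tensorMul (coeff b Φ) (coeff b Φ) i j := by
  classical
  obtain ⟨Θ, hΘ⟩ := exists_composition b Φ Φ
  obtain ⟨Δ, hΔ, -⟩ := h _ Θ (commuting_of_coeff_eq_tensorMul b hc hc hΘ)
  replace hΔ : ∀ i j, Δ (coeff b Φ i j) = tensorMul (coeff b Φ) (coeff b Φ) i j := fun i j => by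
    rw [(reparametrize_eq_iff b).1 hΔ, hΘ]
  obtain ⟨ε, hε, -⟩ := h Scalars.{u} (MinTensor.inl M Scalars.{u}) (commuting_inl Ψ)
  replace hε : ∀ i j, ε (coeff b Φ i j) = if i = j then 1 else 0 := fun i j => by
    rw [(reparametrize_eq_iff b).1 hε, coeff_inl]
  -- `Scalars` is a universe lift of `ℂ`, whereas a counit takes values in `ℂ` itself.
  let down : Scalars.{u} →⋆ₐ[ℂ] ℂ :=
    { ULift.algEquiv.toAlgHom with map_star' := fun _ => rfl }
  have hdown : toScalars.{u}.comp (down.comp ε) = ε := by ext x; rfl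
  refine ⟨Δ, ⟨?_, down.comp ε, ?_, ?_⟩, hΔ⟩
  · exact h.hom_ext_coeff b hc (coassociative_coeff hΔ)
  · rw [hdown]
    refine h.hom_ext_coeff b hc fun i j => ?_
    rw [StarAlgHom.comp_apply, hΔ, map_tensorMul]
    simp only [tensorMul, hε, StarAlgHom.coe_id, id, TensorProduct.ite_tmul,
      apply_ite (MinTensor.ofAlg _ _), map_zero, Finset.sum_ite_eq,
      Finset.mem_univ, if_true]
    rfl
  · rw [hdown]
    refine h.hom_ext_coeff b hc fun i j => ?_
    rw [StarAlgHom.comp_apply, hΔ, map_tensorMul]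
    simp only [tensorMul, hε, StarAlgHom.coe_id, id, TensorProduct.tmul_ite,
      apply_ite (MinTensor.ofAlg _ _), map_zero, Finset.sum_ite_eq',
      Finset.mem_univ, if_true]
    rfl

theorem IsFamilyOfAllMaps.existsUnique_comul (h : IsFamilyOfAllMaps Φ) :
    ∃! Δ : E →⋆ₐ[ℂ] MinTensor E E, IsCompositionComul Φ Δ := by
  let b := Module.Free.chooseBasis ℂ M
  obtain ⟨Θ, hΘ⟩ := exists_composition b Φ Φ
  obtain ⟨Δ, hΔ, -⟩ := h _ Θ
  refine ⟨Δ, (isCompositionComul_iff b).2 fun i j => ?_, fun Δ' hΔ' => ?_⟩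
  · rw [(reparametrize_eq_iff b).1 hΔ, hΘ]
  · refine h.hom_ext_coeff b fun i j => ?_
    rw [(isCompositionComul_iff b).1 hΔ', (reparametrize_eq_iff b).1 hΔ, hΘ]

/-- A homomorphism onto the coefficients of a generating family is surjective, since its range is
closed. -/
theorem surjective_of_reparametrize_eq {U : Type u} [CStarAlgebra U] {Φ' : QuantumFamily M M U}
    (hgen : ∀ S : StarSubalgebra ℂ U, IsClosed (S : Set U) → (∀ i j, coeff b Φ' i j ∈ S) → S = ⊤)
    {Λ : E →⋆ₐ[ℂ] U} (hΛ : reparametrize Φ Λ = Φ') : Function.Surjective Λ := by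
  have h : Λ.range = ⊤ := hgen _ (isClosed_range_starAlgHom Λ) fun i j =>
    ⟨coeff b Φ i j, (reparametrize_eq_iff b).1 hΛ i j⟩
  intro x
  have hx : x ∈ Λ.range := h ▸ StarSubalgebra.mem_top
  exact hx

end Semigroup

end QuantumFamilies

end

theorem mainTheorem4 {M D : Type u} [CStarAlgebra M] [FiniteDimensional ℂ M] [CStarAlgebra D]
    (Ψ : QuantumFamily M M D) :
    ∃ (U : Type u) (_ : CStarAlgebra U) (Φ : QuantumFamily M M U),
      -- existence and uniqueness of the universal quantum family
      IsUniversalCommuting Ψ Φ ∧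
      Commuting Φ Ψ ∧
      (∀ (U' : Type u) [CStarAlgebra U'] (Φ' : QuantumFamily M M U'),
        IsUniversalCommuting Ψ Φ' → Commuting Φ' Ψ →
          ∃! e : U ≃⋆ₐ[ℂ] U', reparametrize Φ (e : U →⋆ₐ[ℂ] U') = Φ') ∧
      -- the quantum semigroup structure
      ∃ Δ : U →⋆ₐ[ℂ] MinTensor U U, IsQuantumSemigroupWithUnit Δ ∧
        ∀ (E : Type u) [CStarAlgebra E] (Φ_E : QuantumFamily M M E), IsFamilyOfAllMaps Φ_E →
          (∃! Δ_E : E →⋆ₐ[ℂ] MinTensor E E, IsCompositionComul Φ_E Δ_E) ∧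
          (∃! Λ : E →⋆ₐ[ℂ] U, reparametrize Φ_E Λ = Φ) ∧
          ∀ (Δ_E : E →⋆ₐ[ℂ] MinTensor E E) (Λ : E →⋆ₐ[ℂ] U),
            IsCompositionComul Φ_E Δ_E → reparametrize Φ_E Λ = Φ →
              Function.Surjective Λ ∧ Δ.comp Λ = (MinTensor.map Λ Λ).comp Δ_E := by
  let b := Module.Free.chooseBasis ℂ M
  obtain ⟨U, _, Φ, hU, hc, hgen⟩ := exists_universal b Ψ
  obtain ⟨Δ, hΔ, hΔΦ⟩ := hU.exists_comul b hc
  refine ⟨U, inferInstance, Φ, hU, hc,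
    fun U' _ Φ' hU' hc' => hU.existsUnique_starAlgEquiv hc hU' hc', Δ, hΔ,
    fun E _ Φ_E hE => ⟨hE.existsUnique_comul, hE U Φ, fun Δ_E Λ hΔ_E hΛ =>
      ⟨surjective_of_reparametrize_eq b hgen hΛ, hE.hom_ext_coeff b fun i j => ?_⟩⟩⟩
  rw [StarAlgHom.comp_apply, StarAlgHom.comp_apply, (isCompositionComul_iff b).1 hΔ_E,
    map_tensorMul]
  simp only [(reparametrize_eq_iff b).1 hΛ, hΔΦ]
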